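/- Let $X\subseteq\mathbb R^d$, $Y\subseteq\mathbb R^n$ be closed convex sets and $f:X\times Y\to\mathbb R$ continuous, with $f(\cdot,y)$ $\rho$-weakly convex on $X$ for every $y\in Y$ (i.e. $f(\cdot,y)+\frac{\rho}{2}\|\cdot\|^2$ is convex) and $f(x,\cdot)$ $\lambda$-strongly concave on $Y$ for every $x\in X$, where $\rho,\lambda>0$. Put $P(x)=\max_{y\in Y}f(x,y)$ for $x\in X$ and let $\partial$ denote the limiting (Fréchet) subdifferential of a function with domain $X$ (or $Y$), i.e. of its extension by $+\infty$. A stochastic oracle returns, at $(x,y)\in X\times Y$ and for a random sample $\xi$, vectors $\mathcal G_x(x,y;\xi)$, $\mathcal G_y(x,y;\xi)$ with $\mathrm E[\mathcal G_x(x,y;\xi)]\in\partial_x f(x,y)$, $-\mathrm E[\mathcal G_y(x,y;\xi)]\in\partial_y(-f)(x,y)$, $\mathrm E\|\mathcal G_x(x,y;\xi)\|^2\le M_1^2$ and $\mathrm E\|\mathcal G_y(x,y;\xi)\|^2\le M_2^2$. Let $(x_0,y_0)\in X\times Y$ and $\epsilon_0>0$ satisfy $\mathrm{Gap}(x_0,y_0)=\sup_{y\in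 Y}f(x_0,y)-\inf_{x\in X}f(x,y_0)\le\epsilon_0$. Epoch-GDA: let $\gamma=2\rho$, $(x_0^1,y_0^1)=(x_0,y_0)$. In epoch $k=1,2,\dots$ put $T_k=\lceil 106(k+1)/3\rceil$, $\eta_x^k=\frac{4}{\rho(k+1)}$, $\eta_y^k=\frac{2}{\lambda(k+1)}$; for $t=0,\dots,T_k-1$ draw a fresh independent sample $\xi_t^k$ and set $$x_{t+1}^k=\arg\min_{x\in X}\ x^\top\mathcal G_x(x_t^k,y_t^k;\xi_t^k)+\tfrac{1}{2\eta_x^k}\|x-x_t^k\|^2+\tfrac{\gamma}{2}\|x-x_0^k\|^2,\qquad y_{t+1}^k=\arg\min_{y\in Y}\ -y^\top\mathcal G_y(x_t^k,y_t^k;\xi_t^k)+\tfrac{1}{2\eta_y^k}\|y-y_t^k\|^2;$$ then $(x_0^{k+1},y_0^{k+1})=\frac1{T_k}\sum_{t=0}^{T_k-1}(x_t^k,y_t^k)$. Then for every $k\ge1$ the function $\hat f_k(x,y)=f(x,y)+\frac{\gamma}{2}\|x-x_0^k\|^2$ has a unique saddle point $(\hat x_k^*,\hat y_k^*)$ on $X\times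 Y$ (minimizing in $x$, maximizing in $y$). For $\epsilon>0$ let $a(\epsilon)=\frac{1696\gamma}{\epsilon^2}\left(\frac{2M_1^2}{\rho}+\frac{M_2^2}{\lambda}\right)$ and let $K(\epsilon)=\max\left\{1,\ \left\lceil\max\left\{a(\epsilon)\ln a(\epsilon),\ \frac{1376\,\gamma\,\epsilon_0}{5\epsilon^2}\right\}\right\rceil\right\}$, where $0\ln0=0$. If $K\ge K(\epsilon)$ is an integer and $\tau$ is uniformly distributed on $\{1,\dots,K\}$, independently of the samples, then $$\mathrm E\big[\mathrm{dist}(0,\partial P(\hat x_\tau^*))^2\big]\ \le\ \gamma^2\,\mathrm E\|\hat x_\tau^*-x_0^\tau\|^2\ \le\ \epsilon^2 .$$ Hence $x_0^\tau$ is nearly $\epsilon$-stationary for $\min_{x\in X}P(x)$ in mean square: there is a random $z$ with $\mathrm E\|z-x_0^\tau\|^2\le(\epsilon/\gamma)^2$ and $\mathrm E[\mathrm{dist}(0,\partial P(z))^2]\le\epsilon^2$. The total number of iterations is $\sum_{k=1}^{K(\epsilon)}T_k=O\big(\epsilon^{-4}\ln^2(1/\epsilon)\big)=\tilde O(\epsilon^{-4})$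 as $\epsilon\to0^+$, all other parameters being fixed. -/

import Mathlib

open MeasureTheory ProbabilityTheory Filter Topology

noncomputable section

/-- `g` is `ρ`-weakly convex on `s`: `g + (ρ / 2) ‖·‖²` is convex on `s`. -/
def WeaklyConvexOn {E : Type*} [NormedAddCommGroup E] [InnerProductSpace ℝ E]
    (s : Set E) (ρ : ℝ) (g : E → ℝ) : Prop :=
  ConvexOn ℝ s fun x => g x + ρ / 2 * ‖x‖ ^ 2

/-- Fréchet subdifferential at `x` of a function `g` whose domain is `s` (equivalently, of `g`
extended by `+∞` outside `s`): all `v` such that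
`liminf (g z - g x - ⟪v, z - x⟫) / ‖z - x‖ ≥ 0` as `z → x` in `s`. -/
def frechetSubdiff {E : Type*} [NormedAddCommGroup E] [InnerProductSpace ℝ E]
    (s : Set E) (g : E → ℝ) (x : E) : Set E :=
  {v | x ∈ s ∧ ∀ c > 0, ∀ᶠ z in 𝓝[s] x, -(c * ‖z - x‖) ≤ g z - g x - inner ℝ v (z - x)}

/-- Limiting subdifferential at `x` of a function `g` whose domain is `s`: limits of Fréchet
subgradients at points `u n → x` with `g (u n) → g x`. -/
def limitingSubdiff {E : Type*} [NormedAddCommGroup E] [InnerProductSpace ℝ E]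
    (s : Set E) (g : E → ℝ) (x : E) : Set E :=
  {v | x ∈ s ∧ ∃ u w : ℕ → E, (∀ n, w n ∈ frechetSubdiff s g (u n)) ∧
    Tendsto u atTop (𝓝 x) ∧ Tendsto (fun n => g (u n)) atTop (𝓝 (g x)) ∧
    Tendsto w atTop (𝓝 v)}

/-- The primal objective `P(x) = max_{y ∈ Y} f(x, y)`. -/
def primalObj {E F : Type*} (Y : Set F) (f : E → F → ℝ) (x : E) : ℝ :=
  sSup (f x '' Y)

/-- The duality gap `max_{y' ∈ Y} f(x, y') - min_{x' ∈ X} f(x', y)`, as an extended real. -/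
def dualityGap {E F : Type*} (X : Set E) (Y : Set F) (f : E → F → ℝ) (x : E) (y : F) : EReal :=
  (⨆ y' ∈ Y, (f x y' : EReal)) - ⨅ x' ∈ X, (f x' y : EReal)

/-- A minimizer of `g` over `s` (an arbitrary point if there is none). -/
def argMinOver {E : Type*} [Nonempty E] (s : Set E) (g : E → ℝ) : E :=
  Classical.epsilon fun x => x ∈ s ∧ IsMinOn g s x

/-- `p` is a point of `X × Y` and a saddle point of `g` there:
`g(p.1, y) ≤ g(p.1, p.2) ≤ g(x, p.2)` for all `x ∈ X`, `y ∈ Y`. -/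
def IsSaddle {E F : Type*} (X : Set E) (Y : Set F) (g : E → F → ℝ) (p : E × F) : Prop :=
  p.1 ∈ X ∧ p.2 ∈ Y ∧ IsSaddlePointOn X Y g p.1 p.2

/-- The saddle point of `g` on `X × Y` (an arbitrary point if there is none). -/
def saddlePoint {E F : Type*} [Nonempty E] [Nonempty F] (X : Set E) (Y : Set F)
    (g : E → F → ℝ) : E × F :=
  Classical.epsilon (IsSaddle X Y g)

/-- The regularized objective `f(x, y) + (γ / 2) ‖x - c‖²` with prox center `c`. -/
def regObj {E F : Type*} [NormedAddCommGroup E] (γ : ℝ) (c : E) (f : E → F → ℝ)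
    (x : E) (y : F) : ℝ :=
  f x y + γ / 2 * ‖x - c‖ ^ 2

/-- The number of inner iterations of epoch `k ≥ 1`: `106 (k + 1) / 3`, rounded up. -/
def epochLen (k : ℕ) : ℕ := ⌈(106 * ((k : ℝ) + 1) / 3 : ℝ)⌉₊

section Algorithm

variable {E F S : Type*} [NormedAddCommGroup E] [InnerProductSpace ℝ E]
  [NormedAddCommGroup F] [InnerProductSpace ℝ F]

/-- One primal-dual update from the point `p`, with prox center `c`, step sizes `ηx`, `ηy` and
the stochastic subgradients `Gx`, `Gy` evaluated at `p` and at the sample `s`. -/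
def gdaStep (X : Set E) (Y : Set F) (Gx : E → F → S → E) (Gy : E → F → S → F)
    (γ ηx ηy : ℝ) (c : E) (p : E × F) (s : S) : E × F :=
  (argMinOver X fun x =>
      inner ℝ x (Gx p.1 p.2 s) + 1 / (2 * ηx) * ‖x - p.1‖ ^ 2 + γ / 2 * ‖x - c‖ ^ 2,
   argMinOver Y fun y =>
      -inner ℝ y (Gy p.1 p.2 s) + 1 / (2 * ηy) * ‖y - p.2‖ ^ 2)

/-- The inner iterates `(x_t, y_t)`, `t = 0, 1, …`, of epoch `k`, which starts at `p₀`, has the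
prox center `p₀.1`, the step sizes `4 / (ρ (k + 1))` and `2 / (lam (k + 1))`, and uses the sample
`s t` in the update from `t` to `t + 1`. -/
def epochIter (X : Set E) (Y : Set F) (Gx : E → F → S → E) (Gy : E → F → S → F)
    (γ ρ lam : ℝ) (k : ℕ) (p₀ : E × F) (s : ℕ → S) : ℕ → E × F
  | 0 => p₀
  | t + 1 => gdaStep X Y Gx Gy γ (4 / (ρ * ((k : ℝ) + 1))) (2 / (lam * ((k : ℝ) + 1))) p₀.1
      (epochIter X Y Gx Gy γ ρ lam k p₀ s t) (s t)

/-- The starting point `(x_0^k, y_0^k)` of epoch `k ≥ 1` (the value at `k = 0` is not used):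
the initial point for `k = 1`, and for `k + 2` the average of the iterates
`t = 0, …, T_{k+1} - 1` of epoch `k + 1`. The sample used in epoch `k` at step `t` is `s k t`. -/
def epochStart (X : Set E) (Y : Set F) (Gx : E → F → S → E) (Gy : E → F → S → F)
    (γ ρ lam : ℝ) (p₀ : E × F) (s : ℕ → ℕ → S) : ℕ → E × F
  | 0 => p₀
  | 1 => p₀
  | k + 2 => (epochLen (k + 1) : ℝ)⁻¹ • ∑ t ∈ Finset.range (epochLen (k + 1)),
      epochIter X Y Gx Gy γ ρ lam (k + 1)
        (epochStart X Y Gx Gy γ ρ lam p₀ s (k + 1)) (s (k + 1)) t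

end Algorithm

/-- The real number whose round-up is the prescribed number of epochs. -/
def epochBound (γ ρ lam M₁ M₂ ε₀ ε : ℝ) : ℝ :=
  max (1696 * γ * (2 * M₁ ^ 2 / ρ + M₂ ^ 2 / lam) / ε ^ 2 *
        Real.log (1696 * γ * (2 * M₁ ^ 2 / ρ + M₂ ^ 2 / lam) / ε ^ 2))
    (1376 * γ * ε₀ / (5 * ε ^ 2))

/-- The prescribed number of epochs: `epochBound` rounded up, and at least one. -/
def numEpochs (γ ρ lam M₁ M₂ ε₀ ε : ℝ) : ℕ :=
  max 1 ⌈epochBound γ ρ lam M₁ M₂ ε₀ ε⌉₊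

/-- The random point `x` is, in mean square, nearly `ε`-stationary for minimizing `ψ` over `s`,
with constant `c`: some random `z` satisfies `E ‖z - x‖² ≤ (c ε)²` and
`E dist(0, ∂ψ(z))² ≤ ε²`. (The distance to the empty set is infinite.) -/
def NearlyStationaryInMean {Ω E : Type*} [MeasurableSpace Ω]
    [NormedAddCommGroup E] [InnerProductSpace ℝ E] [MeasurableSpace E]
    (μ : Measure Ω) (s : Set E) (ψ : E → ℝ) (c ε : ℝ) (x : Ω → E) : Prop :=
  ∃ z : Ω → E, Measurable z ∧
    ∫⁻ ω, ‖z ω - x ω‖ₑ ^ 2 ∂μ ≤ ENNReal.ofReal ((c * ε) ^ 2) ∧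
    ∫⁻ ω, Metric.infEDist 0 (limitingSubdiff s ψ (z ω)) ^ 2 ∂μ ≤ ENNReal.ofReal (ε ^ 2)

end

/-
The primal part of the saddle point of `f(x, y) + (γ / 2) ‖x - c‖²` is the proximal point `x̂` of
the `ρ`-weakly convex function `P` with center `c`, so `γ (c - x̂)` is a subgradient of `P` at `x̂`
and `dist(0, ∂P(x̂)) ≤ γ ‖x̂ - c‖`. It remains to make `‖x̂ - c‖` small on average over the epochs.

Each epoch runs proximal steps on a strongly convex-strongly concave problem for long enough that
the duality gap shrinks by the factor `1/10`, up to a noise term of expectation `O(1/k)`. Moving the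
prox center from `x_0^k` to `x_0^{k+1}` changes the regularized problem, but the gap then lost is
paid for by a decrease of `P`, with a multiple of `ρ ‖x̂_k - x_0^k‖²` left over. These leftovers
telescope: their sum over `K` epochs is at most a multiple of the initial gap plus the accumulated
noise `O(∑ 1/k) = O(log K)`, and `K ≥ a log a` is what makes `a log K = O(K)`.
-/

noncomputable section

section Subdifferential

variable {E : Type*} [NormedAddCommGroup E] [InnerProductSpace ℝ E] {s : Set E} {m : ℝ} {g : E → ℝ}

lemma frechetSubdiff_subset_limitingSubdiff (s : Set E) (g : E → ℝ) (x : E) :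
    frechetSubdiff s g x ⊆ limitingSubdiff s g x := fun v hv =>
  ⟨hv.1, fun _ => x, fun _ => v, fun _ => hv, tendsto_const_nhds, tendsto_const_nhds,
    tendsto_const_nhds⟩

lemma zero_mem_frechetSubdiff_of_isMinOn {x : E} (hx : x ∈ s) (hmin : IsMinOn g s x) :
    0 ∈ frechetSubdiff s g x := by
  refine ⟨hx, fun c hc => ?_⟩
  filter_upwards [self_mem_nhdsWithin] with z hz
  have hnonneg : 0 ≤ c * ‖z - x‖ := by positivity
  have hle : g x ≤ g z := hmin hz
  rw [inner_zero_left]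
  linarith

lemma tendsto_segment_nhdsGT_zero (hs : Convex ℝ s) {x z : E} (hx : x ∈ s) (hz : z ∈ s) :
    Tendsto (fun t : ℝ => (1 - t) • x + t • z) (𝓝[>] 0) (𝓝[s] x) := by
  refine tendsto_nhdsWithin_iff.2 ⟨?_, ?_⟩
  · have hcont : Continuous fun t : ℝ => (1 - t) • x + t • z := by fun_prop
    simpa using (hcont.tendsto 0).mono_left nhdsWithin_le_nhds
  · filter_upwards [Ioo_mem_nhdsGT one_pos] with t ht
    exact hs hx hz (by linarith [ht.2]) ht.1.le (by ring)

lemma le_of_mem_frechetSubdiff (hg : StrongConvexOn s m g) {x v : E}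
    (hv : v ∈ frechetSubdiff s g x) {z : E} (hz : z ∈ s) :
    g x + inner ℝ v (z - x) + m / 2 * ‖z - x‖ ^ 2 ≤ g z := by
  obtain ⟨hx, hv⟩ := hv
  have slope_bound : ∀ c > 0, ∀ᶠ t : ℝ in 𝓝[>] 0,
      inner ℝ v (z - x) + (1 - t) * (m / 2 * ‖z - x‖ ^ 2) - c * ‖z - x‖ ≤ g z - g x := by
    intro c hc
    filter_upwards [(tendsto_segment_nhdsGT_zero hg.1 hx hz).eventually (hv c hc),
      Ioo_mem_nhdsGT one_pos] with t hsub ⟨ht₀, ht₁⟩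
    have hconv := hg.2 hx hz (by linarith : (0 : ℝ) ≤ 1 - t) ht₀.le (by ring)
    have hdiff : (1 - t) • x + t • z - x = t • (z - x) := by module
    rw [hdiff, norm_smul, inner_smul_right, Real.norm_of_nonneg ht₀.le] at hsub
    simp only [smul_eq_mul, norm_sub_rev x z] at hconv
    exact le_of_mul_le_mul_left (by linarith) ht₀
  have approx_bound : ∀ c > 0,
      inner ℝ v (z - x) + m / 2 * ‖z - x‖ ^ 2 - c * ‖z - x‖ ≤ g z - g x := by
    intro c hc
    have hcont : Continuous fun t : ℝ =>
      inner ℝ v (z - x) + (1 - t) * (m / 2 * ‖z - x‖ ^ 2) - c * ‖z - x‖ := by fun_prop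
    refine le_of_tendsto ?_ (slope_bound c hc)
    simpa using (hcont.tendsto 0).mono_left nhdsWithin_le_nhds
  have hcont : Continuous fun c : ℝ =>
    inner ℝ v (z - x) + m / 2 * ‖z - x‖ ^ 2 - c * ‖z - x‖ := by fun_prop
  have hlim := (hcont.tendsto 0).mono_left (nhdsWithin_le_nhds (s := Set.Ioi 0))
  have := le_of_tendsto hlim (eventually_mem_nhdsWithin.mono approx_bound)
  linarith

lemma le_of_mem_limitingSubdiff (hg : StrongConvexOn s m g) {x v : E}
    (hv : v ∈ limitingSubdiff s g x) {z : E} (hz : z ∈ s) :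
    g x + inner ℝ v (z - x) + m / 2 * ‖z - x‖ ^ 2 ≤ g z := by
  obtain ⟨-, u, w, hw, hu, hgu, hwv⟩ := hv
  have hlim : Tendsto (fun n => g (u n) + inner ℝ (w n) (z - u n) + m / 2 * ‖z - u n‖ ^ 2) atTop
      (𝓝 (g x + inner ℝ v (z - x) + m / 2 * ‖z - x‖ ^ 2)) :=
    (hgu.add (hwv.inner (hu.const_sub z))).add (((hu.const_sub z).norm.pow 2).const_mul _)
  exact le_of_tendsto' hlim fun n => le_of_mem_frechetSubdiff hg (hw n) hz

lemma smul_sub_mem_frechetSubdiff_of_isMinOn {γ : ℝ} (hγ : 0 < γ) {c x : E}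
    (hx : x ∈ s) (hmin : IsMinOn (fun z => g z + γ / 2 * ‖z - c‖ ^ 2) s x) :
    γ • (c - x) ∈ frechetSubdiff s g x := by
  refine ⟨hx, fun e he => ?_⟩
  filter_upwards [mem_nhdsWithin_of_mem_nhds (Metric.ball_mem_nhds x (ε := 2 * e / γ)
    (by positivity)), self_mem_nhdsWithin] with z hz hzs
  have hle : g x + γ / 2 * ‖x - c‖ ^ 2 ≤ g z + γ / 2 * ‖z - c‖ ^ 2 := hmin hzs
  have hexpand : ‖z - c‖ ^ 2 = ‖z - x‖ ^ 2 - 2 * inner ℝ (c - x) (z - x) + ‖x - c‖ ^ 2 := by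
    rw [show z - c = (z - x) - (c - x) by abel, norm_sub_sq_real, real_inner_comm,
      norm_sub_rev x c]
  rw [Metric.mem_ball, dist_eq_norm, lt_div_iff₀ hγ] at hz
  have hsmall : γ / 2 * ‖z - x‖ ^ 2 ≤ e * ‖z - x‖ := by nlinarith [norm_nonneg (z - x)]
  rw [hexpand] at hle
  rw [real_inner_smul_left]
  linarith

end Subdifferential

section StrongConvexity

variable {E : Type*} [NormedAddCommGroup E] [InnerProductSpace ℝ E] {s : Set E} {m : ℝ} {g : E → ℝ}

lemma quadratic_growth_of_isMinOn (hg : StrongConvexOn s m g) {x : E} (hx : x ∈ s)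
    (hmin : IsMinOn g s x) {z : E} (hz : z ∈ s) : g x + m / 2 * ‖z - x‖ ^ 2 ≤ g z := by
  simpa using le_of_mem_frechetSubdiff hg (zero_mem_frechetSubdiff_of_isMinOn hx hmin) hz

lemma quadratic_growth_of_isMaxOn (hg : StrongConcaveOn s m g) {x : E} (hx : x ∈ s)
    (hmax : IsMaxOn g s x) {z : E} (hz : z ∈ s) : g z + m / 2 * ‖z - x‖ ^ 2 ≤ g x := by
  have hneg : StrongConvexOn s m (-g) := UniformConcaveOn.neg hg
  have := quadratic_growth_of_isMinOn hneg hx hmax.neg hz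
  simp only [Pi.neg_apply] at this
  linarith

lemma norm_sub_le_of_isMinOn_of_sub_eq_inner_add {h : E → ℝ} (hg : StrongConvexOn s m g)
    (hh : StrongConvexOn s m h) {a : E} {b : ℝ} (hsub : ∀ z ∈ s, g z - h z = inner ℝ a z + b)
    {x y : E} (hx : x ∈ s) (hxmin : IsMinOn g s x) (hy : y ∈ s) (hymin : IsMinOn h s y) :
    m * ‖x - y‖ ≤ ‖a‖ := by
  obtain hxy | hxy := (norm_nonneg (x - y)).eq_or_lt
  · simp [← hxy]
  have hgx := quadratic_growth_of_isMinOn hg hx hxmin hy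
  have hhy := quadratic_growth_of_isMinOn hh hy hymin hx
  have hcs : inner ℝ a (y - x) ≤ ‖a‖ * ‖y - x‖ := real_inner_le_norm a (y - x)
  rw [inner_sub_right, norm_sub_rev y x] at hcs
  rw [norm_sub_rev y x] at hgx
  have hsum : m * ‖x - y‖ ^ 2 ≤ ‖a‖ * ‖x - y‖ := by linarith [hsub x hx, hsub y hy]
  exact le_of_mul_le_mul_right (by linarith) hxy

lemma strongConvexOn_add_sq_norm_sub (hg : StrongConvexOn s m g) (a : ℝ) (c : E) :
    StrongConvexOn s (m + a) fun x => g x + a / 2 * ‖x - c‖ ^ 2 := by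
  rw [strongConvexOn_iff_convex] at hg ⊢
  have haff : ConvexOn ℝ s fun x => innerₗ E (-(a • c)) x + a / 2 * ‖c‖ ^ 2 :=
    ((innerₗ E (-(a • c))).convexOn hg.1).add_const _
  refine (hg.add haff).congr fun x _ => ?_
  simp only [Pi.add_apply, innerₗ_apply_apply, inner_neg_left, real_inner_smul_left,
    norm_sub_sq_real, real_inner_comm c x]
  ring

lemma bddBelow_image_of_strongConvexOn (hm : 0 < m) (hg : StrongConvexOn s m g) {x₀ : E}
    (hx₀ : x₀ ∈ s) (hlsc : LowerSemicontinuousWithinAt g s x₀) : BddBelow (g '' s) := by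
  obtain ⟨δ, hδ, hball⟩ := Metric.mem_nhdsWithin_iff.1 (hlsc (g x₀ - 1) (by linarith))
  refine ⟨g x₀ - 1 - 4 / (m * δ ^ 2), ?_⟩
  rintro _ ⟨z, hz, rfl⟩
  have hnonneg : 0 ≤ 4 / (m * δ ^ 2) := by positivity
  obtain hr | hr := lt_or_ge ‖z - x₀‖ δ
  · have : g x₀ - 1 < g z := hball ⟨by simpa [dist_eq_norm] using hr, hz⟩
    linarith
  set r := ‖z - x₀‖ with hr_def
  have hr₀ : 0 < r := hδ.trans_le hr
  set t := δ / (2 * r) with ht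
  have htr : t * r = δ / 2 := by rw [ht]; field_simp
  have ht₀ : 0 < t := by positivity
  have ht₁ : t ≤ 1 / 2 := by rw [ht, div_le_div_iff₀ (by positivity) two_pos]; linarith
  -- Strong convexity carries the lower bound from the point of the segment at distance `δ / 2`
  -- from `x₀` out to `z`.
  have hmem : (1 - t) • x₀ + t • z ∈ Metric.ball x₀ δ ∩ s := by
    refine ⟨?_, hg.1 hx₀ hz (by linarith) ht₀.le (by ring)⟩
    have hsub : (1 - t) • x₀ + t • z - x₀ = t • (z - x₀) := by module
    rw [Metric.mem_ball, dist_eq_norm, hsub, norm_smul, Real.norm_of_nonneg ht₀.le, htr]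
    linarith
  have hlower : g x₀ - 1 < g ((1 - t) • x₀ + t • z) := hball hmem
  have hconv := hg.2 hx₀ hz (by linarith : (0 : ℝ) ≤ 1 - t) ht₀.le (by ring)
  simp only [smul_eq_mul, norm_sub_rev x₀ z, ← hr_def] at hconv
  have hgrowth : m / 4 * r ^ 2 - 2 * r / δ ≤ g z - g x₀ := by
    refine le_of_mul_le_mul_left ?_ ht₀
    have hdiv : t * (2 * r / δ) = 1 := by rw [ht]; field_simp
    have hcoef : 0 ≤ t * (1 / 2 - t) * (m / 2 * r ^ 2) :=
      mul_nonneg (mul_nonneg ht₀.le (by linarith)) (by positivity)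
    linarith
  have hsq : m / 4 * r ^ 2 - 2 * r / δ
      = m / 4 * (r - 4 / (m * δ)) ^ 2 - 4 / (m * δ ^ 2) := by field_simp; ring
  have : 0 ≤ m / 4 * (r - 4 / (m * δ)) ^ 2 := by positivity
  linarith

lemma mul_sq_norm_sub_le_of_forall_le (hg : StrongConvexOn s m g) {b : ℝ}
    (hb : ∀ z ∈ s, b ≤ g z) {u v : E} (hu : u ∈ s) (hv : v ∈ s) :
    m * ‖u - v‖ ^ 2 ≤ 4 * ((g u - b) + (g v - b)) := by
  have hmid := hb _ (hg.1 hu hv one_half_pos.le one_half_pos.le (add_halves 1))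
  have hconv := hg.2 hu hv one_half_pos.le one_half_pos.le (add_halves 1)
  simp only [smul_eq_mul] at hconv
  linarith

lemma cauchySeq_of_tendsto_of_forall_le (hm : 0 < m) (hg : StrongConvexOn s m g) {b : ℝ}
    (hb : ∀ z ∈ s, b ≤ g z) {u : ℕ → E} (hu : ∀ n, u n ∈ s)
    (hlim : Tendsto (fun n => g (u n)) atTop (𝓝 b)) : CauchySeq u := by
  refine Metric.cauchySeq_iff.2 fun ε hε => ?_
  have hpos : b < b + m * ε ^ 2 / 8 := lt_add_of_pos_right b (by positivity)
  obtain ⟨N, hN⟩ := eventually_atTop.1 (hlim.eventually (gt_mem_nhds hpos))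
  refine ⟨N, fun i hi j hj => ?_⟩
  have hij := mul_sq_norm_sub_le_of_forall_le hg hb (hu i) (hu j)
  have hlt : m * ‖u i - u j‖ ^ 2 < m * ε ^ 2 := by linarith [hN i hi, hN j hj]
  rw [dist_eq_norm]
  exact lt_of_pow_lt_pow_left₀ 2 hε.le (lt_of_mul_lt_mul_left hlt hm.le)

theorem exists_isMinOn_of_strongConvexOn [CompleteSpace E] (hm : 0 < m)
    (hg : StrongConvexOn s m g) (hs : IsClosed s) (hne : s.Nonempty)
    (hlsc : LowerSemicontinuousOn g s) : ∃ x ∈ s, IsMinOn g s x := by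
  have hbdd := bddBelow_image_of_strongConvexOn hm hg hne.some_mem (hlsc _ hne.some_mem)
  have hb : ∀ z ∈ s, sInf (g '' s) ≤ g z := fun z hz => csInf_le hbdd ⟨z, hz, rfl⟩
  obtain ⟨a, -, ha, hmem⟩ := exists_seq_tendsto_sInf (hne.image g) hbdd
  choose u hus hua using hmem
  obtain rfl : (fun n => g (u n)) = a := funext hua
  obtain ⟨x, hux⟩ :=
    cauchySeq_tendsto_of_complete (cauchySeq_of_tendsto_of_forall_le hm hg hb hus ha)
  have hx : x ∈ s := hs.mem_of_tendsto hux (Eventually.of_forall hus)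
  refine ⟨x, hx, fun z hz => le_trans ?_ (hb z hz)⟩
  by_contra! hlt
  obtain ⟨c, hbc, hcx⟩ := exists_between hlt
  have hc : ∀ᶠ n in atTop, c < g (u n) :=
    (tendsto_nhdsWithin_iff.2 ⟨hux, Eventually.of_forall hus⟩).eventually (hlsc x hx c hcx)
  obtain ⟨n, hcn, hnc⟩ := (hc.and (ha.eventually (gt_mem_nhds hbc))).exists
  exact hcn.not_gt hnc

theorem exists_isMaxOn_of_strongConcaveOn [CompleteSpace E] (hm : 0 < m)
    (hg : StrongConcaveOn s m g) (hs : IsClosed s) (hne : s.Nonempty)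
    (husc : UpperSemicontinuousOn g s) : ∃ x ∈ s, IsMaxOn g s x := by
  have hneg : StrongConvexOn s m (-g) := UniformConcaveOn.neg hg
  have hlsc : LowerSemicontinuousOn (-g) s := fun x hx a ha => by
    filter_upwards [husc x hx (-a) (lt_neg.1 ha)] with z hz using lt_neg.1 hz
  obtain ⟨x, hx, hmin⟩ := exists_isMinOn_of_strongConvexOn hm hneg hs hne hlsc
  exact ⟨x, hx, by simpa using hmin.neg⟩

end StrongConvexity

section Saddle

section PrimalObj

variable {E F : Type*} {X : Set E} {Y : Set F} {h : E → F → ℝ}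

lemma primalObj_eq_of_isMaxOn {x : E} {y : F} (hy : y ∈ Y) (hmax : IsMaxOn (h x) Y y) :
    primalObj Y h x = h x y :=
  IsGreatest.csSup_eq ⟨⟨y, hy, rfl⟩, by rintro _ ⟨z, hz, rfl⟩; exact hmax hz⟩

lemma IsSaddle.isMaxOn {p : E × F} (hp : IsSaddle X Y h p) : IsMaxOn (h p.1) Y p.2 :=
  fun y hy => hp.2.2 p.1 hp.1 y hy

lemma IsSaddle.primalObj_eq {p : E × F} (hp : IsSaddle X Y h p) :
    primalObj Y h p.1 = h p.1 p.2 :=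
  primalObj_eq_of_isMaxOn hp.2.1 hp.isMaxOn

end PrimalObj

variable {E F : Type*} [NormedAddCommGroup E] [InnerProductSpace ℝ E]
  [NormedAddCommGroup F] [InnerProductSpace ℝ F]

/-- A strongly convex-concave saddle problem: `h` is `m`-strongly convex and lower semicontinuous
in the first variable, `l`-strongly concave and upper semicontinuous in the second, on a product
of nonempty closed sets. -/
structure StrongConvexConcave (X : Set E) (Y : Set F) (m l : ℝ) (h : E → F → ℝ) : Prop where
  closed_left : IsClosed X
  closed_right : IsClosed Y
  nonempty_left : X.Nonempty
  nonempty_right : Y.Nonempty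
  pos_left : 0 < m
  pos_right : 0 < l
  convex : ∀ y ∈ Y, StrongConvexOn X m fun x => h x y
  concave : ∀ x ∈ X, StrongConcaveOn Y l (h x)
  lsc_left : ∀ y ∈ Y, LowerSemicontinuousOn (fun x => h x y) X
  usc_right : ∀ x ∈ X, UpperSemicontinuousOn (h x) Y

namespace StrongConvexConcave

variable {X : Set E} {Y : Set F} {m l : ℝ} {h : E → F → ℝ}

lemma convex_left (H : StrongConvexConcave X Y m l h) : Convex ℝ X :=
  (H.convex _ H.nonempty_right.some_mem).1

lemma convexOn (H : StrongConvexConcave X Y m l h) {y : F} (hy : y ∈ Y) :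
    ConvexOn ℝ X fun x => h x y :=
  ((H.convex y hy).strictConvexOn H.pos_left).convexOn

lemma concaveOn (H : StrongConvexConcave X Y m l h) {x : E} (hx : x ∈ X) :
    ConcaveOn ℝ Y (h x) :=
  ((H.concave x hx).strictConcaveOn H.pos_right).concaveOn

lemma exists_isMinOn [CompleteSpace E] (H : StrongConvexConcave X Y m l h) {y : F}
    (hy : y ∈ Y) : ∃ x ∈ X, IsMinOn (fun x => h x y) X x :=
  exists_isMinOn_of_strongConvexOn H.pos_left (H.convex y hy) H.closed_left H.nonempty_left
    (H.lsc_left y hy)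

variable [CompleteSpace F]

lemma exists_isMaxOn (H : StrongConvexConcave X Y m l h) {x : E} (hx : x ∈ X) :
    ∃ y ∈ Y, IsMaxOn (h x) Y y :=
  exists_isMaxOn_of_strongConcaveOn H.pos_right (H.concave x hx) H.closed_right
    H.nonempty_right (H.usc_right x hx)

lemma le_primalObj (H : StrongConvexConcave X Y m l h) {x : E} (hx : x ∈ X)
    {y : F} (hy : y ∈ Y) : h x y ≤ primalObj Y h x := by
  obtain ⟨z, hz, hmax⟩ := H.exists_isMaxOn hx
  rw [primalObj_eq_of_isMaxOn hz hmax]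
  exact hmax hy

lemma strongConvexOn_primalObj (H : StrongConvexConcave X Y m l h) :
    StrongConvexOn X m (primalObj Y h) := by
  refine ⟨H.convex_left, fun x hx z hz a b ha hb hab => ?_⟩
  obtain ⟨y, hy, hmax⟩ := H.exists_isMaxOn (H.convex_left hx hz ha hb hab)
  rw [primalObj_eq_of_isMaxOn hy hmax]
  refine ((H.convex y hy).2 hx hz ha hb hab).trans ?_
  gcongr
  · exact H.le_primalObj hx hy
  · exact H.le_primalObj hz hy

lemma lowerSemicontinuousOn_primalObj (H : StrongConvexConcave X Y m l h) :
    LowerSemicontinuousOn (primalObj Y h) X := by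
  intro x hx a ha
  obtain ⟨y, hy, hmax⟩ := H.exists_isMaxOn hx
  rw [primalObj_eq_of_isMaxOn hy hmax] at ha
  filter_upwards [H.lsc_left y hy x hx a ha, self_mem_nhdsWithin] with z hz hzX
  exact hz.trans_le (H.le_primalObj hzX hy)

lemma isMinOn_primalObj_of_isSaddle (H : StrongConvexConcave X Y m l h)
    {p : E × F} (hp : IsSaddle X Y h p) : IsMinOn (primalObj Y h) X p.1 := fun x hx =>
  hp.primalObj_eq.trans_le <| (hp.2.2 x hx p.2 hp.2.1).trans (H.le_primalObj hx hp.2.1)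

-- The witness `y` is the best response to the point `(1 - t) x' + t x`.
lemma exists_le_and_sq_norm_sub_le (H : StrongConvexConcave X Y m l h) {x' : E} {y' : F}
    (hx' : x' ∈ X) (hmin : IsMinOn (primalObj Y h) X x') (hy' : y' ∈ Y)
    (hmax : IsMaxOn (h x') Y y') {x : E} (hx : x ∈ X) {t : ℝ} (ht₀ : 0 < t) (ht₁ : t < 1) :
    ∃ y ∈ Y, h x' y' ≤ h x y ∧
      (1 - t) * (l / 2 * ‖y - y'‖ ^ 2) ≤ t * (primalObj Y h x - h x' y') := by
  have ht : 0 < 1 - t := sub_pos.2 ht₁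
  have hmem : (1 - t) • x' + t • x ∈ X := H.convex_left hx' hx ht.le ht₀.le (by ring)
  obtain ⟨y, hy, hymax⟩ := H.exists_isMaxOn hmem
  have hlower : h x' y' ≤ h ((1 - t) • x' + t • x) y := by
    rw [← primalObj_eq_of_isMaxOn hy' hmax, ← primalObj_eq_of_isMaxOn hy hymax]
    exact hmin hmem
  have hconv := (H.convexOn hy).2 hx' hx ht.le ht₀.le (by ring)
  simp only [smul_eq_mul] at hconv
  have hgrowth := mul_le_mul_of_nonneg_left
    (quadratic_growth_of_isMaxOn (H.concave x' hx') hy' hmax hy) ht.le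
  have hl : 0 ≤ (1 - t) * (l / 2 * ‖y - y'‖ ^ 2) := by have := H.pos_right; positivity
  refine ⟨y, hy, le_of_mul_le_mul_left (by linarith) ht₀, ?_⟩
  have := mul_le_mul_of_nonneg_left (H.le_primalObj hx hy) ht₀.le
  linarith

variable [CompleteSpace E]

theorem exists_isSaddle (H : StrongConvexConcave X Y m l h) : ∃ p, IsSaddle X Y h p := by
  obtain ⟨x', hx', hmin⟩ := exists_isMinOn_of_strongConvexOn H.pos_left
    H.strongConvexOn_primalObj H.closed_left H.nonempty_left H.lowerSemicontinuousOn_primalObj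
  obtain ⟨y', hy', hmax⟩ := H.exists_isMaxOn hx'
  refine ⟨(x', y'), hx', hy', fun x hx y hy => (hmax hy).trans ?_⟩
  have hresponse : ∀ k : ℕ, ∃ y ∈ Y, h x' y' ≤ h x y ∧
      ‖y - y'‖ ^ 2 ≤ 2 * (primalObj Y h x - h x' y') / l * (1 / ((k : ℝ) + 1)) := by
    intro k
    have ht₁ : (1 : ℝ) / (k + 2) < 1 := by rw [div_lt_one (by positivity)]; linarith
    obtain ⟨y, hy, hle, hsq⟩ :=
      H.exists_le_and_sq_norm_sub_le hx' hmin hy' hmax hx (by positivity) ht₁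
    refine ⟨y, hy, hle, ?_⟩
    have hl := H.pos_right
    field_simp at hsq ⊢
    linarith
  choose y hyY hle hsq using hresponse
  have hlim : Tendsto y atTop (𝓝[Y] y') := by
    refine tendsto_nhdsWithin_iff.2 ⟨?_, Eventually.of_forall hyY⟩
    rw [tendsto_iff_norm_sub_tendsto_zero]
    have hzero := tendsto_one_div_add_atTop_nhds_zero_nat (𝕜 := ℝ).const_mul
      (2 * (primalObj Y h x - h x' y') / l)
    rw [mul_zero] at hzero
    have hsqrt := (squeeze_zero (fun k => sq_nonneg ‖y k - y'‖) hsq hzero).sqrt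
    simpa using hsqrt
  by_contra! hlt
  obtain ⟨k, hk⟩ := (hlim.eventually (H.usc_right x hx y' hy' _ hlt)).exists
  exact hk.not_ge (hle k)

theorem existsUnique_isSaddle (H : StrongConvexConcave X Y m l h) : ∃! p, IsSaddle X Y h p := by
  obtain ⟨p, hp⟩ := H.exists_isSaddle
  refine ⟨p, hp, fun q hq => ?_⟩
  have hfst : q.1 = p.1 := (H.strongConvexOn_primalObj.strictConvexOn H.pos_left).eq_of_isMinOn
    (H.isMinOn_primalObj_of_isSaddle hq) (H.isMinOn_primalObj_of_isSaddle hp) hq.1 hp.1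
  have hsnd : q.2 = p.2 := ((H.concave p.1 hp.1).strictConcaveOn H.pos_right).eq_of_isMaxOn
    (hfst ▸ hq.isMaxOn) hp.isMaxOn hq.2.1 hp.2.1
  exact Prod.ext hfst hsnd

lemma isSaddle_saddlePoint (H : StrongConvexConcave X Y m l h) :
    IsSaddle X Y h (saddlePoint X Y h) :=
  Classical.epsilon_spec H.exists_isSaddle

end StrongConvexConcave

end Saddle

section Regularization

variable {E F : Type*} [NormedAddCommGroup E] [InnerProductSpace ℝ E]
  [NormedAddCommGroup F] [InnerProductSpace ℝ F]

lemma WeaklyConvexOn.strongConvexOn {s : Set E} {ρ : ℝ} {g : E → ℝ} (hg : WeaklyConvexOn s ρ g) :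
    StrongConvexOn s (-ρ) g := by
  rw [strongConvexOn_iff_convex]
  refine hg.congr fun x _ => ?_
  ring

/-- A weakly convex-strongly concave saddle problem: `f` is `ρ`-weakly convex and lower
semicontinuous in the first variable, `lam`-strongly concave and upper semicontinuous in the
second, on a product of nonempty closed sets. -/
structure WeaklyConvexStronglyConcave (X : Set E) (Y : Set F) (ρ lam : ℝ) (f : E → F → ℝ) :
    Prop where
  closed_left : IsClosed X
  closed_right : IsClosed Y
  nonempty_left : X.Nonempty
  nonempty_right : Y.Nonempty
  pos_left : 0 < ρ
  pos_right : 0 < lam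
  weaklyConvex : ∀ y ∈ Y, WeaklyConvexOn X ρ fun x => f x y
  concave : ∀ x ∈ X, StrongConcaveOn Y lam (f x)
  lsc_left : ∀ y ∈ Y, LowerSemicontinuousOn (fun x => f x y) X
  usc_right : ∀ x ∈ X, UpperSemicontinuousOn (f x) Y

/-- The primal part of the saddle point of `f(x, y) + (γ / 2) ‖x - c‖²`; for a weakly convex
`f(·, y)` and large `γ` this is the proximal point of the primal objective with center `c`. -/
def saddleProx (X : Set E) (Y : Set F) (γ : ℝ) (f : E → F → ℝ) (c : E) : E :=
  (saddlePoint X Y (regObj γ c f)).1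

namespace WeaklyConvexStronglyConcave

variable {X : Set E} {Y : Set F} {ρ lam γ : ℝ} {f : E → F → ℝ}

lemma convex_left (W : WeaklyConvexStronglyConcave X Y ρ lam f) : Convex ℝ X :=
  have ⟨y, hy⟩ := W.nonempty_right
  (W.weaklyConvex y hy).1

lemma convex_right (W : WeaklyConvexStronglyConcave X Y ρ lam f) : Convex ℝ Y :=
  have ⟨x, hx⟩ := W.nonempty_left
  (W.concave x hx).1

lemma strongConvexConcave_regObj (W : WeaklyConvexStronglyConcave X Y ρ lam f) (hγ : ρ < γ)
    (c : E) : StrongConvexConcave X Y (γ - ρ) lam (regObj γ c f) where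
  closed_left := W.closed_left
  closed_right := W.closed_right
  nonempty_left := W.nonempty_left
  nonempty_right := W.nonempty_right
  pos_left := sub_pos.2 hγ
  pos_right := W.pos_right
  convex y hy := by
    have := strongConvexOn_add_sq_norm_sub (W.weaklyConvex y hy).strongConvexOn γ c
    rwa [neg_add_eq_sub] at this
  concave x hx := by
    have := (W.concave x hx).add (uniformConcaveOn_zero.2
      (concaveOn_const (γ / 2 * ‖x - c‖ ^ 2) (W.concave x hx).1))
    rwa [add_zero] at this
  lsc_left y hy := (W.lsc_left y hy).add
    (Continuous.continuousOn (by fun_prop)).lowerSemicontinuousOn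
  usc_right x hx := (W.usc_right x hx).add upperSemicontinuousOn_const

variable [CompleteSpace F]

lemma exists_isMaxOn (W : WeaklyConvexStronglyConcave X Y ρ lam f) {x : E} (hx : x ∈ X) :
    ∃ y ∈ Y, IsMaxOn (f x) Y y :=
  exists_isMaxOn_of_strongConcaveOn W.pos_right (W.concave x hx) W.closed_right
    W.nonempty_right (W.usc_right x hx)

lemma le_primalObj (W : WeaklyConvexStronglyConcave X Y ρ lam f) {x : E} (hx : x ∈ X) {y : F}
    (hy : y ∈ Y) : f x y ≤ primalObj Y f x := by
  obtain ⟨z, hz, hmax⟩ := W.exists_isMaxOn hx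
  rw [primalObj_eq_of_isMaxOn hz hmax]
  exact hmax hy

lemma primalObj_regObj (W : WeaklyConvexStronglyConcave X Y ρ lam f) (γ : ℝ) (c : E) {x : E}
    (hx : x ∈ X) : primalObj Y (regObj γ c f) x = primalObj Y f x + γ / 2 * ‖x - c‖ ^ 2 := by
  obtain ⟨y, hy, hmax⟩ := W.exists_isMaxOn hx
  have hreg : IsMaxOn (regObj γ c f x) Y y := fun z hz => by
    simpa only [regObj, add_le_add_iff_right] using hmax hz
  rw [primalObj_eq_of_isMaxOn hy hreg, primalObj_eq_of_isMaxOn hy hmax, regObj]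

lemma strongConvexOn_primalObj_add (W : WeaklyConvexStronglyConcave X Y ρ lam f) (hγ : ρ < γ)
    (c : E) : StrongConvexOn X (γ - ρ) fun x => primalObj Y f x + γ / 2 * ‖x - c‖ ^ 2 := by
  have h := (W.strongConvexConcave_regObj hγ c).strongConvexOn_primalObj
  refine ⟨h.1, fun x hx z hz a b ha hb hab => ?_⟩
  have := h.2 hx hz ha hb hab
  rwa [W.primalObj_regObj γ c hx, W.primalObj_regObj γ c hz,
    W.primalObj_regObj γ c (h.1 hx hz ha hb hab)] at this

variable [CompleteSpace E]

lemma isSaddle_regObj (W : WeaklyConvexStronglyConcave X Y ρ lam f) (hγ : ρ < γ) (c : E) :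
    IsSaddle X Y (regObj γ c f) (saddlePoint X Y (regObj γ c f)) :=
  (W.strongConvexConcave_regObj hγ c).isSaddle_saddlePoint

lemma saddleProx_mem (W : WeaklyConvexStronglyConcave X Y ρ lam f) (hγ : ρ < γ) (c : E) :
    saddleProx X Y γ f c ∈ X :=
  (W.isSaddle_regObj hγ c).1

lemma isMinOn_saddleProx (W : WeaklyConvexStronglyConcave X Y ρ lam f) (hγ : ρ < γ) (c : E) :
    IsMinOn (fun z => primalObj Y f z + γ / 2 * ‖z - c‖ ^ 2) X (saddleProx X Y γ f c) := by
  intro z hz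
  have h := (W.strongConvexConcave_regObj hγ c).isMinOn_primalObj_of_isSaddle
    (W.isSaddle_regObj hγ c) hz
  rwa [Set.mem_ofPred_eq, W.primalObj_regObj γ c hz,
    W.primalObj_regObj γ c (W.isSaddle_regObj hγ c).1] at h

lemma infEDist_limitingSubdiff_le (W : WeaklyConvexStronglyConcave X Y ρ lam f) (hγ : ρ < γ)
    (c : E) :
    Metric.infEDist 0 (limitingSubdiff X (primalObj Y f) (saddleProx X Y γ f c)) ≤
      ENNReal.ofReal γ * ‖saddleProx X Y γ f c - c‖ₑ := by
  have hγ₀ : 0 < γ := W.pos_left.trans hγ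
  have hmem := frechetSubdiff_subset_limitingSubdiff _ _ _ <|
    smul_sub_mem_frechetSubdiff_of_isMinOn hγ₀ (W.saddleProx_mem hγ c) (W.isMinOn_saddleProx hγ c)
  refine (Metric.infEDist_le_edist_of_mem hmem).trans_eq ?_
  rw [edist_zero_left, ← enorm_eq_nnnorm, enorm_smul, ← enorm_neg (c - _), neg_sub,
    Real.enorm_of_nonneg hγ₀.le]

lemma mul_norm_saddleProx_sub_le (W : WeaklyConvexStronglyConcave X Y ρ lam f) (hγ : ρ < γ)
    (c c' : E) :
    (γ - ρ) * ‖saddleProx X Y γ f c - saddleProx X Y γ f c'‖ ≤ γ * ‖c - c'‖ := by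
  have hsub : ∀ z ∈ X, (primalObj Y f z + γ / 2 * ‖z - c‖ ^ 2)
      - (primalObj Y f z + γ / 2 * ‖z - c'‖ ^ 2)
      = inner ℝ (γ • (c' - c)) z + γ / 2 * (‖c‖ ^ 2 - ‖c'‖ ^ 2) := by
    intro z _
    rw [real_inner_smul_left, inner_sub_left, norm_sub_sq_real, norm_sub_sq_real,
      real_inner_comm z c, real_inner_comm z c']
    ring
  have h := norm_sub_le_of_isMinOn_of_sub_eq_inner_add (W.strongConvexOn_primalObj_add hγ c)
    (W.strongConvexOn_primalObj_add hγ c') hsub (W.saddleProx_mem hγ c)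
    (W.isMinOn_saddleProx hγ c) (W.saddleProx_mem hγ c') (W.isMinOn_saddleProx hγ c')
  rwa [norm_smul, Real.norm_of_nonneg (W.pos_left.trans hγ).le, norm_sub_rev c'] at h

lemma continuous_saddleProx (W : WeaklyConvexStronglyConcave X Y ρ lam f) (hγ : ρ < γ) :
    Continuous (saddleProx X Y γ f) := by
  have hpos : 0 < γ - ρ := sub_pos.2 hγ
  refine continuous_iff_continuousAt.2 fun c => tendsto_iff_norm_sub_tendsto_zero.2 ?_
  refine squeeze_zero (g := fun c' => γ / (γ - ρ) * ‖c' - c‖) (fun _ => norm_nonneg _)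
    (fun c' => ?_) (Continuous.tendsto' (by fun_prop) c 0 (by simp))
  rw [div_mul_eq_mul_div, le_div_iff₀' hpos]
  exact W.mul_norm_saddleProx_sub_le hγ c' c

end WeaklyConvexStronglyConcave

end Regularization

section ProximalStep

variable {E : Type*} [NormedAddCommGroup E] [InnerProductSpace ℝ E]

lemma real_inner_le_half_sq_add {η : ℝ} (hη : 0 < η) (a b : E) :
    inner ℝ a b ≤ η / 2 * ‖a‖ ^ 2 + 1 / (2 * η) * ‖b‖ ^ 2 := by
  have hsq : 0 ≤ (η * ‖a‖ - ‖b‖) ^ 2 / (2 * η) := by positivity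
  have hexpand : (η * ‖a‖ - ‖b‖) ^ 2 / (2 * η)
      = η / 2 * ‖a‖ ^ 2 + 1 / (2 * η) * ‖b‖ ^ 2 - ‖a‖ * ‖b‖ := by
    field_simp
    ring
  linarith [real_inner_le_norm a b]

/-- The objective of the proximal step from `p` along `-g` with step size `η`, regularized
around `c`. -/
def proxObj (γ η : ℝ) (c p g x : E) : ℝ :=
  inner ℝ x g + 1 / (2 * η) * ‖x - p‖ ^ 2 + γ / 2 * ‖x - c‖ ^ 2

/-- The proximal step from `p` along `-g` with step size `η`, regularized around `c`. -/
def proxStep (X : Set E) (γ η : ℝ) (c p g : E) : E :=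
  argMinOver X (proxObj γ η c p g)

variable {X : Set E} {γ η : ℝ}

lemma strongConvexOn_proxObj (hX : Convex ℝ X) (γ η : ℝ) (c p g : E) :
    StrongConvexOn X (1 / η + γ) (proxObj γ η c p g) := by
  have hlin : StrongConvexOn X 0 fun x => inner ℝ x g :=
    strongConvexOn_zero.2 <|
      ((innerₗ E g).convexOn hX).congr fun x _ => real_inner_comm x g
  have h := strongConvexOn_add_sq_norm_sub (strongConvexOn_add_sq_norm_sub hlin (1 / η) p) γ c
  rw [zero_add] at h
  convert h using 3
  rw [proxObj, div_div, mul_comm η 2]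

variable [CompleteSpace E] (hX : Convex ℝ X) (hXc : IsClosed X) (hη : 0 < η) (hγ : 0 ≤ γ)
include hX hXc hη hγ

lemma proxStep_spec (hne : X.Nonempty) (c p g : E) :
    proxStep X γ η c p g ∈ X ∧ IsMinOn (proxObj γ η c p g) X (proxStep X γ η c p g) :=
  Classical.epsilon_spec <| exists_isMinOn_of_strongConvexOn (by positivity)
    (strongConvexOn_proxObj hX γ η c p g) hXc hne
    (Continuous.continuousOn (by unfold proxObj; fun_prop)).lowerSemicontinuousOn

lemma norm_proxStep_sub_le (hne : X.Nonempty) (c p g c' p' g' : E) :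
    ‖proxStep X γ η c p g - proxStep X γ η c' p' g'‖ ≤
      ‖p - p'‖ + η * γ * ‖c - c'‖ + η * ‖g - g'‖ := by
  obtain ⟨hx, hmin⟩ := proxStep_spec hX hXc hη hγ hne c p g
  obtain ⟨hx', hmin'⟩ := proxStep_spec hX hXc hη hγ hne c' p' g'
  have hsub : ∀ z ∈ X, proxObj γ η c p g z - proxObj γ η c' p' g' z
      = inner ℝ ((g - g') - (1 / η) • (p - p') - γ • (c - c')) z
        + (1 / (2 * η) * (‖p‖ ^ 2 - ‖p'‖ ^ 2) + γ / 2 * (‖c‖ ^ 2 - ‖c'‖ ^ 2)) := by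
    intro z _
    simp only [proxObj, norm_sub_sq_real]
    simp only [real_inner_comm z, inner_sub_right, inner_smul_right]
    field_simp
    ring
  have hle := norm_sub_le_of_isMinOn_of_sub_eq_inner_add (strongConvexOn_proxObj hX γ η c p g)
    (strongConvexOn_proxObj hX γ η c' p' g') hsub hx hmin hx' hmin'
  have htri : ‖(g - g') - (1 / η) • (p - p') - γ • (c - c')‖ ≤
      ‖g - g'‖ + 1 / η * ‖p - p'‖ + γ * ‖c - c'‖ := by
    refine (norm_sub_le _ _).trans (add_le_add ((norm_sub_le _ _).trans_eq ?_) ?_)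
    · rw [norm_smul, Real.norm_of_nonneg (by positivity)]
    · rw [norm_smul, Real.norm_of_nonneg hγ]
  set N := ‖proxStep X γ η c p g - proxStep X γ η c' p' g'‖
  have hN : 0 ≤ γ * N := mul_nonneg hγ (norm_nonneg _)
  refine le_of_mul_le_mul_left ?_ (one_div_pos.2 hη)
  have hcancel : 1 / η * (‖p - p'‖ + η * γ * ‖c - c'‖ + η * ‖g - g'‖)
      = ‖g - g'‖ + 1 / η * ‖p - p'‖ + γ * ‖c - c'‖ := by
    field_simp
    ring
  linarith

lemma continuous_proxStep (hne : X.Nonempty) :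
    Continuous fun q : E × E × E => proxStep X γ η q.1 q.2.1 q.2.2 := by
  refine continuous_iff_continuousAt.2 fun q => tendsto_iff_norm_sub_tendsto_zero.2 ?_
  exact squeeze_zero (fun _ => norm_nonneg _)
    (fun r => norm_proxStep_sub_le hX hXc hη hγ hne r.1 r.2.1 r.2.2 q.1 q.2.1 q.2.2)
    (Continuous.tendsto' (by fun_prop) q 0 (by simp))

lemma proxStep_self {c : E} (hc : c ∈ X) : proxStep X γ η c c 0 = c := by
  obtain ⟨hx, hmin⟩ := proxStep_spec hX hXc hη hγ ⟨c, hc⟩ c c 0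
  have hcmin : IsMinOn (proxObj γ η c c 0) X c := fun z _ => by
    have : 0 ≤ 1 / (2 * η) * ‖z - c‖ ^ 2 + γ / 2 * ‖z - c‖ ^ 2 := by positivity
    simpa [proxObj] using this
  exact ((strongConvexOn_proxObj hX γ η c c 0).strictConvexOn (by positivity)).eq_of_isMinOn
    hmin hcmin hx hc

lemma norm_proxStep_sub_center_le {c : E} (hc : c ∈ X) (p g : E) :
    ‖proxStep X γ η c p g - c‖ ≤ ‖p - c‖ + η * ‖g‖ := by
  simpa [proxStep_self hX hXc hη hγ hc] using
    norm_proxStep_sub_le hX hXc hη hγ ⟨c, hc⟩ c p g c c 0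

lemma inner_add_le_of_proxStep (c p g : E) {z : E} (hz : z ∈ X) :
    inner ℝ g (p - z) + γ / 2 * ‖proxStep X γ η c p g - c‖ ^ 2
        + (1 / (2 * η) + γ / 2) * ‖z - proxStep X γ η c p g‖ ^ 2 ≤
      1 / (2 * η) * ‖z - p‖ ^ 2 + γ / 2 * ‖z - c‖ ^ 2 + η / 2 * ‖g‖ ^ 2 := by
  obtain ⟨hx, hmin⟩ := proxStep_spec hX hXc hη hγ ⟨z, hz⟩ c p g
  have hgrowth := quadratic_growth_of_isMinOn (strongConvexOn_proxObj hX γ η c p g) hx hmin hz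
  set x := proxStep X γ η c p g
  have hyoung := real_inner_le_half_sq_add hη g (p - x)
  have hη' : 1 / η = 2 * (1 / (2 * η)) := by field_simp
  simp only [proxObj, hη', real_inner_comm g] at hgrowth
  rw [norm_sub_rev p x, inner_sub_right] at hyoung
  rw [inner_sub_right]
  linarith

/-- The stochastic error terms in the regret bound for proximal steps with stochastic gradients
`g t` of mean `gb t` taken at the points `x t`. -/
def proxNoise (η : ℝ) (g gb x : ℕ → E) (T : ℕ) : ℝ :=
  η / 2 * ∑ t ∈ Finset.range T, ‖g t‖ ^ 2
    + ∑ t ∈ Finset.range T, inner ℝ (gb t - g t) (x t - x 0)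
    + η / 2 * ‖∑ t ∈ Finset.range T, (gb t - g t)‖ ^ 2

variable {g x : ℕ → E} (hstep : ∀ t, x (t + 1) = proxStep X γ η (x 0) (x t) (g t))
include hstep

lemma sum_inner_sampled_le_of_proxStep {z : E} (hz : z ∈ X) (T : ℕ) :
    ∑ t ∈ Finset.range T, (inner ℝ (g t) (x t - z) + γ / 2 * ‖z - x t‖ ^ 2
          + γ / 2 * ‖x t - x 0‖ ^ 2 - γ / 2 * ‖z - x 0‖ ^ 2)
        + γ / 2 * ‖x T - x 0‖ ^ 2 + (1 / (2 * η) + γ / 2) * ‖z - x T‖ ^ 2 ≤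
      (1 / (2 * η) + γ / 2) * ‖z - x 0‖ ^ 2 + η / 2 * ∑ t ∈ Finset.range T, ‖g t‖ ^ 2 := by
  induction T with
  | zero => simp
  | succ T ih =>
    have hone := inner_add_le_of_proxStep hX hXc hη hγ (x 0) (x T) (g T) hz
    rw [← hstep T] at hone
    rw [Finset.sum_range_succ, Finset.sum_range_succ]
    linarith

lemma sum_inner_le_of_proxStep (gb : ℕ → E) {z : E} (hz : z ∈ X) (T : ℕ) :
    ∑ t ∈ Finset.range T, (inner ℝ (gb t) (x t - z) + γ / 2 * ‖z - x t‖ ^ 2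
        + γ / 2 * ‖x t - x 0‖ ^ 2 - γ / 2 * ‖z - x 0‖ ^ 2) ≤
      (1 / η + γ / 2) * ‖z - x 0‖ ^ 2 + proxNoise η g gb x T := by
  have hregret := sum_inner_sampled_le_of_proxStep hX hXc hη hγ hstep hz T
  have hyoung := real_inner_le_half_sq_add hη (∑ t ∈ Finset.range T, (gb t - g t)) (x 0 - z)
  have hsplit : ∑ t ∈ Finset.range T, (inner ℝ (gb t) (x t - z) + γ / 2 * ‖z - x t‖ ^ 2
        + γ / 2 * ‖x t - x 0‖ ^ 2 - γ / 2 * ‖z - x 0‖ ^ 2)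
      = ∑ t ∈ Finset.range T, (inner ℝ (g t) (x t - z) + γ / 2 * ‖z - x t‖ ^ 2
        + γ / 2 * ‖x t - x 0‖ ^ 2 - γ / 2 * ‖z - x 0‖ ^ 2)
      + ∑ t ∈ Finset.range T, inner ℝ (gb t - g t) (x t - x 0)
      + inner ℝ (∑ t ∈ Finset.range T, (gb t - g t)) (x 0 - z) := by
    rw [sum_inner, ← Finset.sum_add_distrib, ← Finset.sum_add_distrib]
    refine Finset.sum_congr rfl fun t _ => ?_
    simp only [inner_sub_left, inner_sub_right]
    ring
  have hlast : 0 ≤ γ / 2 * ‖x T - x 0‖ ^ 2 + (1 / (2 * η) + γ / 2) * ‖z - x T‖ ^ 2 := by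
    positivity
  have hη' : 1 / η = 2 * (1 / (2 * η)) := by field_simp
  rw [norm_sub_rev (x 0)] at hyoung
  rw [hsplit, proxNoise, hη']
  linarith

end ProximalStep

section Gap

lemma sq_norm_sub_le_add {G : Type*} [SeminormedAddCommGroup G] {δ : ℝ} (hδ : 0 < δ) (a b c : G) :
    ‖a - c‖ ^ 2 ≤ (1 + δ) * ‖a - b‖ ^ 2 + (1 + δ⁻¹) * ‖b - c‖ ^ 2 := by
  calc ‖a - c‖ ^ 2 ≤ (‖a - b‖ + ‖b - c‖) ^ 2 := by
        gcongr
        exact norm_sub_le_norm_sub_add_norm_sub a b c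
    _ = (1 + δ) * ‖a - b‖ ^ 2 + (1 + δ⁻¹) * ‖b - c‖ ^ 2
        - δ⁻¹ * (δ * ‖a - b‖ - ‖b - c‖) ^ 2 := by
        field_simp
        ring
    _ ≤ _ := sub_le_self _ (by positivity)

lemma inv_smul_sum_range_mem {G : Type*} [AddCommGroup G] [Module ℝ G] {s : Set G}
    (hs : Convex ℝ s) {x : ℕ → G} (hx : ∀ t, x t ∈ s) {T : ℕ} (hT : 0 < T) :
    (T : ℝ)⁻¹ • ∑ t ∈ Finset.range T, x t ∈ s := by
  rw [Finset.smul_sum]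
  exact hs.sum_mem (fun _ _ => by positivity) (by simp [hT.ne']) fun t _ => hx t

section Dual

variable {E F : Type*} {X : Set E} {Y : Set F} {h : E → F → ℝ}

/-- The dual objective `min_{x ∈ X} h(x, y)`. -/
def dualObj (X : Set E) (h : E → F → ℝ) (y : F) : ℝ :=
  sInf ((fun x => h x y) '' X)

/-- The duality gap of `h` at `(x, y)` as a real number; unlike `dualityGap` it is meaningful only
if the extrema are finite. -/
def saddleGap (X : Set E) (Y : Set F) (h : E → F → ℝ) (x : E) (y : F) : ℝ :=
  primalObj Y h x - dualObj X h y

lemma dualObj_eq_of_isMinOn {x : E} {y : F} (hx : x ∈ X) (hmin : IsMinOn (fun x => h x y) X x) :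
    dualObj X h y = h x y :=
  IsLeast.csInf_eq ⟨⟨x, hx, rfl⟩, by rintro _ ⟨z, hz, rfl⟩; exact hmin hz⟩

lemma saddleGap_eq_sub {x x' : E} {y y' : F} (hx' : x' ∈ X)
    (hmin : IsMinOn (fun x => h x y) X x') (hy' : y' ∈ Y) (hmax : IsMaxOn (h x) Y y') :
    saddleGap X Y h x y = h x y' - h x' y := by
  rw [saddleGap, primalObj_eq_of_isMaxOn hy' hmax, dualObj_eq_of_isMinOn hx' hmin]

end Dual

variable {E F : Type*} [NormedAddCommGroup E] [InnerProductSpace ℝ E]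
  [NormedAddCommGroup F] [InnerProductSpace ℝ F]

namespace StrongConvexConcave

variable {X : Set E} {Y : Set F} {m l : ℝ} {h : E → F → ℝ}

lemma average_sub_le (H : StrongConvexConcave X Y m l h) {x : ℕ → E} {y : ℕ → F}
    (hx : ∀ t, x t ∈ X) (hy : ∀ t, y t ∈ Y) {u : E} (hu : u ∈ X) {v : F} (hv : v ∈ Y) {T : ℕ}
    (hT : 0 < T) :
    h ((T : ℝ)⁻¹ • ∑ t ∈ Finset.range T, x t) v - h u ((T : ℝ)⁻¹ • ∑ t ∈ Finset.range T, y t) ≤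
      (T : ℝ)⁻¹ * ∑ t ∈ Finset.range T, (h (x t) v - h u (y t)) := by
  have hw : ∑ _t ∈ Finset.range T, (T : ℝ)⁻¹ = 1 := by simp [hT.ne']
  have hw₀ : ∀ t ∈ Finset.range T, (0 : ℝ) ≤ (T : ℝ)⁻¹ := fun _ _ => by positivity
  rw [Finset.smul_sum, Finset.smul_sum, Finset.sum_sub_distrib, mul_sub, Finset.mul_sum,
    Finset.mul_sum]
  exact sub_le_sub ((H.convexOn hv).map_sum_le hw₀ hw fun t _ => hx t)
    ((H.concaveOn hu).le_map_sum hw₀ hw fun t _ => hy t)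

lemma sq_dist_bestResponse_saddle_le (H : StrongConvexConcave X Y m l h) {p : E × F}
    (hp : IsSaddle X Y h p) {x u : E} (hx : x ∈ X) {y v : F} (hy : y ∈ Y) (hu : u ∈ X)
    (hmin : IsMinOn (fun x => h x y) X u) (hv : v ∈ Y) (hmax : IsMaxOn (h x) Y v) :
    m / 2 * ‖p.1 - u‖ ^ 2 + l / 2 * ‖p.2 - v‖ ^ 2 ≤ saddleGap X Y h x y := by
  have hu_growth := quadratic_growth_of_isMinOn (H.convex y hy) hu hmin hp.1
  have hv_growth := quadratic_growth_of_isMaxOn (H.concave x hx) hv hmax hp.2.1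
  have := hp.2.2 x hx y hy
  rw [saddleGap_eq_sub hu hmin hv hmax]
  linarith

variable [CompleteSpace E]

lemma dualObj_le (H : StrongConvexConcave X Y m l h) {x : E} (hx : x ∈ X) {y : F} (hy : y ∈ Y) :
    dualObj X h y ≤ h x y := by
  obtain ⟨z, hz, hmin⟩ := H.exists_isMinOn hy
  rw [dualObj_eq_of_isMinOn hz hmin]
  exact hmin hx

variable [CompleteSpace F]

lemma sub_le_saddleGap (H : StrongConvexConcave X Y m l h) {x u : E} (hx : x ∈ X) (hu : u ∈ X)
    {y v : F} (hy : y ∈ Y) (hv : v ∈ Y) : h x v - h u y ≤ saddleGap X Y h x y :=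
  sub_le_sub (H.le_primalObj hx hv) (H.dualObj_le hu hy)

lemma saddleGap_nonneg (H : StrongConvexConcave X Y m l h) {x : E} (hx : x ∈ X) {y : F}
    (hy : y ∈ Y) : 0 ≤ saddleGap X Y h x y := by
  simpa using H.sub_le_saddleGap hx hx hy hy

lemma sq_dist_saddle_le (H : StrongConvexConcave X Y m l h) {p : E × F} (hp : IsSaddle X Y h p)
    {x : E} (hx : x ∈ X) {y : F} (hy : y ∈ Y) :
    m / 2 * ‖x - p.1‖ ^ 2 + l / 2 * ‖y - p.2‖ ^ 2 ≤ saddleGap X Y h x y := by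
  have hx_growth := quadratic_growth_of_isMinOn (H.convex p.2 hp.2.1) hp.1
    (fun z hz => hp.2.2 z hz p.2 hp.2.1) hx
  have hy_growth := quadratic_growth_of_isMaxOn (H.concave p.1 hp.1) hp.2.1 hp.isMaxOn hy
  have := H.sub_le_saddleGap hx hp.1 hy hp.2.1
  linarith

lemma sq_dist_bestResponse_le (H : StrongConvexConcave X Y m l h) {x₀ x u : E} (hx₀ : x₀ ∈ X)
    (hx : x ∈ X) {y₀ y v : F} (hy₀ : y₀ ∈ Y) (hy : y ∈ Y) (hu : u ∈ X)
    (hmin : IsMinOn (fun x => h x y) X u) (hv : v ∈ Y) (hmax : IsMaxOn (h x) Y v) :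
    m * ‖u - x₀‖ ^ 2 + l * ‖v - y₀‖ ^ 2 ≤
      4 * (saddleGap X Y h x₀ y₀ + saddleGap X Y h x y) := by
  obtain ⟨p, hp⟩ := H.exists_isSaddle
  have hstart := H.sq_dist_saddle_le hp hx₀ hy₀
  have hresponse := H.sq_dist_bestResponse_saddle_le hp hx hy hu hmin hv hmax
  have hu_dist := mul_le_mul_of_nonneg_left (sq_norm_sub_le_add one_pos u p.1 x₀) H.pos_left.le
  have hv_dist := mul_le_mul_of_nonneg_left (sq_norm_sub_le_add one_pos v p.2 y₀) H.pos_right.le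
  rw [norm_sub_rev x₀, norm_sub_rev y₀] at hstart
  rw [norm_sub_rev p.1, norm_sub_rev p.2] at hresponse
  linarith

end StrongConvexConcave

/-- A run of simultaneous proximal steps for the saddle problem of `f(x, y) + (γ / 2) ‖x - x 0‖²`.
The steps at `(x t, y t)` use the (stochastic) gradients `gx t` of `f(·, y t)` and `gy t` of
`-f(x t, ·)`; their means `gbx t` and `gby t` are true limiting subgradients. -/
structure ProxTrajectory (X : Set E) (Y : Set F) (f : E → F → ℝ) (γ ηx ηy : ℝ)
    (x gx gbx : ℕ → E) (y gy gby : ℕ → F) : Prop where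
  step_left : ∀ t, x (t + 1) = proxStep X γ ηx (x 0) (x t) (gx t)
  step_right : ∀ t, y (t + 1) = proxStep Y 0 ηy (y 0) (y t) (gy t)
  mean_mem_left : ∀ t, gbx t ∈ limitingSubdiff X (fun z => f z (y t)) (x t)
  mean_mem_right : ∀ t, gby t ∈ limitingSubdiff Y (fun z => -f (x t) z) (y t)

namespace WeaklyConvexStronglyConcave

variable {X : Set E} {Y : Set F} {ρ lam γ ηx ηy : ℝ} {f : E → F → ℝ}
  {x gx gbx : ℕ → E} {y gy gby : ℕ → F}

lemma sub_le_of_mem_limitingSubdiff (W : WeaklyConvexStronglyConcave X Y ρ lam f) (hγ : ρ ≤ γ)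
    {c x gx u : E} {y gy v : F} (hgx : gx ∈ limitingSubdiff X (fun z => f z y) x)
    (hgy : gy ∈ limitingSubdiff Y (fun z => -f x z) y) (hu : u ∈ X) (hv : v ∈ Y) :
    regObj γ c f x v - regObj γ c f u y ≤
      (inner ℝ gx (x - u) + γ / 2 * ‖u - x‖ ^ 2 + γ / 2 * ‖x - c‖ ^ 2 - γ / 2 * ‖u - c‖ ^ 2)
        + inner ℝ gy (y - v) := by
  have hx := le_of_mem_limitingSubdiff (W.weaklyConvex y hgy.1).strongConvexOn hgx hu
  have hy := le_of_mem_limitingSubdiff (W.concave x hgx.1).neg hgy hv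
  have hconcave : 0 ≤ lam / 2 * ‖v - y‖ ^ 2 := by have := W.pos_right; positivity
  have hweak : ρ / 2 * ‖u - x‖ ^ 2 ≤ γ / 2 * ‖u - x‖ ^ 2 := by gcongr
  simp only [inner_sub_right, Pi.neg_apply] at hx hy ⊢
  simp only [regObj]
  linarith

variable [CompleteSpace E] [CompleteSpace F]

lemma sum_sub_le_of_proxTrajectory (W : WeaklyConvexStronglyConcave X Y ρ lam f) (hγ : ρ ≤ γ)
    (hηx : 0 < ηx) (hηy : 0 < ηy) (R : ProxTrajectory X Y f γ ηx ηy x gx gbx y gy gby)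
    {u : E} (hu : u ∈ X) {v : F} (hv : v ∈ Y) (T : ℕ) :
    ∑ t ∈ Finset.range T, (regObj γ (x 0) f (x t) v - regObj γ (x 0) f u (y t)) ≤
      (1 / ηx + γ / 2) * ‖u - x 0‖ ^ 2 + 1 / ηy * ‖v - y 0‖ ^ 2
        + (proxNoise ηx gx gbx x T + proxNoise ηy gy gby y T) := by
  have hX := (W.weaklyConvex v hv).1
  have hY := (W.concave u hu).1
  have hleft := sum_inner_le_of_proxStep hX W.closed_left hηx (W.pos_left.le.trans hγ)
    R.step_left gbx hu T
  have hright := sum_inner_le_of_proxStep hY W.closed_right hηy le_rfl R.step_right gby hv T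
  have hterm := Finset.sum_le_sum fun t (_ : t ∈ Finset.range T) =>
    W.sub_le_of_mem_limitingSubdiff hγ (c := x 0) (R.mean_mem_left t) (R.mean_mem_right t) hu hv
  rw [Finset.sum_add_distrib] at hterm
  simp only [zero_div, zero_mul, add_zero, sub_zero] at hright
  linarith

lemma saddleGap_average_le (W : WeaklyConvexStronglyConcave X Y ρ lam f) (hγ : ρ < γ)
    (hηx : 0 < ηx) (hηy : 0 < ηy) (R : ProxTrajectory X Y f γ ηx ηy x gx gbx y gy gby) {T : ℕ}
    (hT : 0 < T) {θ : ℝ} (hTx : 1 / ηx + γ / 2 ≤ T * (θ * (γ - ρ)))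
    (hTy : 1 / ηy ≤ T * (θ * lam)) :
    (1 - 4 * θ) * saddleGap X Y (regObj γ (x 0) f) ((T : ℝ)⁻¹ • ∑ t ∈ Finset.range T, x t)
        ((T : ℝ)⁻¹ • ∑ t ∈ Finset.range T, y t) ≤
      4 * θ * saddleGap X Y (regObj γ (x 0) f) (x 0) (y 0)
        + (proxNoise ηx gx gbx x T + proxNoise ηy gy gby y T) / T := by
  have H := W.strongConvexConcave_regObj hγ (x 0)
  have hT₀ : (0 : ℝ) < T := Nat.cast_pos.2 hT
  have hx : ∀ t, x t ∈ X := fun t => (R.mean_mem_left t).1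
  have hy : ∀ t, y t ∈ Y := fun t => (R.mean_mem_right t).1
  set xb := (T : ℝ)⁻¹ • ∑ t ∈ Finset.range T, x t
  set yb := (T : ℝ)⁻¹ • ∑ t ∈ Finset.range T, y t
  have hxbX : xb ∈ X := inv_smul_sum_range_mem H.convex_left hx hT
  have hybY : yb ∈ Y := inv_smul_sum_range_mem (H.concave _ (hx 0)).1 hy hT
  obtain ⟨u, hu, hmin⟩ := H.exists_isMinOn hybY
  obtain ⟨v, hv, hmax⟩ := H.exists_isMaxOn hxbX
  have hgap : T * saddleGap X Y (regObj γ (x 0) f) xb yb ≤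
      (1 / ηx + γ / 2) * ‖u - x 0‖ ^ 2 + 1 / ηy * ‖v - y 0‖ ^ 2
        + (proxNoise ηx gx gbx x T + proxNoise ηy gy gby y T) := by
    rw [saddleGap_eq_sub hu hmin hv hmax, ← le_inv_mul_iff₀ hT₀]
    exact (H.average_sub_le hx hy hu hv hT).trans <| mul_le_mul_of_nonneg_left
      (W.sum_sub_le_of_proxTrajectory hγ.le hηx hηy R hu hv T) (inv_nonneg.2 hT₀.le)
  have hclose := H.sq_dist_bestResponse_le (hx 0) hxbX (hy 0) hybY hu hmin hv hmax
  have hTθ : 0 ≤ T * θ := by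
    have hγ₀ := W.pos_left.trans hγ
    refine nonneg_of_mul_nonneg_left (le_trans ?_ (hTx.trans_eq (mul_assoc _ _ _).symm))
      H.pos_left
    positivity
  have hu_dist := mul_le_mul_of_nonneg_right hTx (sq_nonneg ‖u - x 0‖)
  have hv_dist := mul_le_mul_of_nonneg_right hTy (sq_nonneg ‖v - y 0‖)
  have hclose' := mul_le_mul_of_nonneg_left hclose hTθ
  rw [← sub_le_iff_le_add', le_div_iff₀ hT₀]
  linarith

lemma dualObj_regObj_add_le (W : WeaklyConvexStronglyConcave X Y ρ lam f) (hγ : ρ < γ) {c : E}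
    (hc : c ∈ X) {y : F} (hy : y ∈ Y) :
    dualObj X (regObj γ c f) y + (γ - ρ) / 2 * ‖saddleProx X Y γ f c - c‖ ^ 2 ≤
      primalObj Y f c := by
  have hmem := W.saddleProx_mem hγ c
  have hgrowth := quadratic_growth_of_isMinOn (W.strongConvexOn_primalObj_add hγ c) hmem
    (W.isMinOn_saddleProx hγ c) hc
  have hweak := (W.strongConvexConcave_regObj hγ c).saddleGap_nonneg hmem hy
  rw [saddleGap, W.primalObj_regObj γ c hmem] at hweak
  rw [sub_self, norm_zero, norm_sub_rev c] at hgrowth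
  linarith

lemma saddleGap_recenter_le (W : WeaklyConvexStronglyConcave X Y ρ lam f) {c c' : E} (hc : c ∈ X)
    (hc' : c' ∈ X) {y : F} (hy : y ∈ Y) :
    1 / 10 * saddleGap X Y (regObj (2 * ρ) c' f) c' y
        + 4 / 5 * (primalObj Y f c' - primalObj Y f c)
        + 2 / 5 * (ρ * ‖saddleProx X Y (2 * ρ) f c - c‖ ^ 2) ≤
      saddleGap X Y (regObj (2 * ρ) c f) c' y := by
  have hγ : ρ < 2 * ρ := by linarith [W.pos_left]
  have H := W.strongConvexConcave_regObj hγ c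
  have H' := W.strongConvexConcave_regObj hγ c'
  obtain ⟨x, hx, hmin⟩ := H'.exists_isMinOn hy
  have hdual := W.dualObj_regObj_add_le hγ hc hy
  have hdual_le := H.dualObj_le hx hy
  have hgrowth := (quadratic_growth_of_isMinOn (H'.convex y hy) hx hmin hc').trans
    (H'.le_primalObj hc' hy)
  have hrecenter := mul_le_mul_of_nonneg_left
    (sq_norm_sub_le_add (δ := 1 / 4) (by norm_num) x c' c) W.pos_left.le
  rw [saddleGap, saddleGap, dualObj_eq_of_isMinOn hx hmin]
  rw [W.primalObj_regObj _ c' hc'] at hgrowth ⊢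
  rw [W.primalObj_regObj _ c hc']
  rw [norm_sub_rev c' x] at hgrowth
  simp only [regObj, sub_self, norm_zero] at hdual_le hgrowth ⊢
  linarith

lemma saddleGap_regObj_self_le (W : WeaklyConvexStronglyConcave X Y ρ lam f) (hγ : ρ < γ)
    {c : E} (hc : c ∈ X) {y : F} (hy : y ∈ Y) {ε : ℝ}
    (hgap : ∀ u ∈ X, ∀ v ∈ Y, f c v - f u y ≤ ε) :
    saddleGap X Y (regObj γ c f) c y ≤ ε := by
  have H := W.strongConvexConcave_regObj hγ c
  obtain ⟨u, hu, hmin⟩ := H.exists_isMinOn hy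
  obtain ⟨v, hv, hmax⟩ := H.exists_isMaxOn hc
  have hreg : 0 ≤ γ / 2 * ‖u - c‖ ^ 2 := by have := W.pos_left.trans hγ; positivity
  have := hgap u hu v hv
  rw [saddleGap_eq_sub hu hmin hv hmax]
  simp only [regObj, sub_self, norm_zero]
  linarith

omit [CompleteSpace E] in
lemma primalObj_sub_le (W : WeaklyConvexStronglyConcave X Y ρ lam f) {c c' : E} (hc : c ∈ X)
    (hc' : c' ∈ X) {y : F} (hy : y ∈ Y) {ε : ℝ} (hgap : ∀ u ∈ X, ∀ v ∈ Y, f c v - f u y ≤ ε) :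
    primalObj Y f c - primalObj Y f c' ≤ ε := by
  obtain ⟨v, hv, hmax⟩ := W.exists_isMaxOn hc
  rw [primalObj_eq_of_isMaxOn hv hmax]
  linarith [hgap c' hc' v hv, W.le_primalObj hc' hy]

-- With `Δ k` the regularized gap at the start of epoch `k`, the two gap estimates combine to
-- `Δ (k + 1) / 10 + 4 / 5 * P (c (k + 1)) + … ≤ Δ k / 10 + 4 / 5 * P (c k) + 106 / 97 * r k`.
lemma sum_sq_dist_saddleProx_le_add (W : WeaklyConvexStronglyConcave X Y ρ lam f) {c : ℕ → E}
    {y : ℕ → F} {r : ℕ → ℝ} (hc : ∀ k, c k ∈ X) (hy : ∀ k, y k ∈ Y)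
    (hstep : ∀ k, 1 ≤ k → saddleGap X Y (regObj (2 * ρ) (c k) f) (c (k + 1)) (y (k + 1)) ≤
      1 / 10 * saddleGap X Y (regObj (2 * ρ) (c k) f) (c k) (y k) + r k) (K : ℕ) :
    1 / 10 * saddleGap X Y (regObj (2 * ρ) (c (K + 1)) f) (c (K + 1)) (y (K + 1))
        + 4 / 5 * (primalObj Y f (c (K + 1)) - primalObj Y f (c 1))
        + 2 / 5 * (ρ * ∑ k ∈ Finset.Icc 1 K, ‖saddleProx X Y (2 * ρ) f (c k) - c k‖ ^ 2) ≤
      1 / 10 * saddleGap X Y (regObj (2 * ρ) (c 1) f) (c 1) (y 1)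
        + ∑ k ∈ Finset.Icc 1 K, r k := by
  induction K with
  | zero => simp
  | succ K ih =>
    rw [Finset.sum_Icc_succ_top K.succ_pos, Finset.sum_Icc_succ_top K.succ_pos]
    have := hstep (K + 1) K.succ_pos
    have := W.saddleGap_recenter_le (hc (K + 1)) (hc (K + 1 + 1)) (hy (K + 1 + 1))
    linarith

lemma sum_sq_dist_saddleProx_le (W : WeaklyConvexStronglyConcave X Y ρ lam f) {c : ℕ → E}
    {y : ℕ → F} {r : ℕ → ℝ} {ε₀ : ℝ} (hc : ∀ k, c k ∈ X) (hy : ∀ k, y k ∈ Y)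
    (hgap : ∀ u ∈ X, ∀ v ∈ Y, f (c 1) v - f u (y 1) ≤ ε₀)
    (hstep : ∀ k, 1 ≤ k → saddleGap X Y (regObj (2 * ρ) (c k) f) (c (k + 1)) (y (k + 1)) ≤
      1 / 10 * saddleGap X Y (regObj (2 * ρ) (c k) f) (c k) (y k) + r k) (K : ℕ) :
    2 / 5 * (ρ * ∑ k ∈ Finset.Icc 1 K, ‖saddleProx X Y (2 * ρ) f (c k) - c k‖ ^ 2) ≤
      9 / 10 * ε₀ + ∑ k ∈ Finset.Icc 1 K, r k := by
  have hγ : ρ < 2 * ρ := by linarith [W.pos_left]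
  have hsum := W.sum_sq_dist_saddleProx_le_add hc hy hstep K
  have hlast := (W.strongConvexConcave_regObj hγ (c (K + 1))).saddleGap_nonneg (hc (K + 1))
    (hy (K + 1))
  have hfirst := W.saddleGap_regObj_self_le hγ (hc 1) (hy 1) hgap
  have hdecrease := W.primalObj_sub_le (hc 1) (hc (K + 1)) (hy 1) hgap
  linarith

end WeaklyConvexStronglyConcave

end Gap

section SecondMoments

variable {Ω H : Type*} [NormedAddCommGroup H] {mΩ : MeasurableSpace Ω} {μ : Measure Ω}

lemma memLp_two_of_lintegral_sq_le {g : Ω → H} (hg : AEStronglyMeasurable g μ) {M : ℝ}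
    (hM : ∫⁻ ω, ‖g ω‖ₑ ^ 2 ∂μ ≤ ENNReal.ofReal (M ^ 2)) :
    MemLp g 2 μ ∧ ∫ ω, ‖g ω‖ ^ 2 ∂μ ≤ M ^ 2 := by
  have he : ∀ ω, ‖g ω‖ₑ ^ 2 = ENNReal.ofReal (‖g ω‖ ^ 2) := fun ω => by
    rw [ENNReal.ofReal_pow (norm_nonneg _), ofReal_norm]
  simp only [he] at hM
  have hnonneg : 0 ≤ᵐ[μ] fun ω => ‖g ω‖ ^ 2 := .of_forall fun ω => sq_nonneg _
  refine ⟨(memLp_two_iff_integrable_sq_norm hg).2 ⟨hg.norm.pow 2, ?_⟩, ?_⟩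
  · exact (hasFiniteIntegral_iff_ofReal hnonneg).2 (hM.trans_lt ENNReal.ofReal_lt_top)
  · rw [integral_eq_lintegral_of_nonneg_ae hnonneg (hg.norm.pow 2)]
    exact ENNReal.toReal_le_of_le_ofReal (sq_nonneg M) hM

lemma sq_norm_integral_le [NormedSpace ℝ H] [IsProbabilityMeasure μ] {g : Ω → H}
    (hg : MemLp g 2 μ) : ‖∫ ω, g ω ∂μ‖ ^ 2 ≤ ∫ ω, ‖g ω‖ ^ 2 ∂μ := by
  have hvar := variance_nonneg (fun ω => ‖g ω‖) μ
  rw [variance_eq_sub hg.norm, sub_nonneg] at hvar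
  exact (pow_le_pow_left₀ (norm_nonneg _) (norm_integral_le_integral_norm _) 2).trans hvar

variable [InnerProductSpace ℝ H]

lemma integrable_inner_of_memLp_two {g h : Ω → H} (hg : MemLp g 2 μ) (hh : MemLp h 2 μ) :
    Integrable (fun ω => inner ℝ (g ω) (h ω)) μ :=
  (hg.norm.integrable_mul hh.norm).mono' (hg.1.inner hh.1)
    (.of_forall fun ω => norm_inner_le_norm (g ω) (h ω))

lemma integral_sq_norm_add {g h : Ω → H} (hg : MemLp g 2 μ) (hh : MemLp h 2 μ) :
    ∫ ω, ‖g ω + h ω‖ ^ 2 ∂μ =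
      ∫ ω, ‖g ω‖ ^ 2 ∂μ + 2 * ∫ ω, inner ℝ (g ω) (h ω) ∂μ + ∫ ω, ‖h ω‖ ^ 2 ∂μ := by
  have hinner := (integrable_inner_of_memLp_two hg hh).const_mul 2
  have hsq : Integrable (fun ω => ‖g ω‖ ^ 2) μ := hg.integrable_norm_pow two_ne_zero
  simp only [norm_add_sq_real]
  rw [integral_add (by exact hsq.add hinner) (hh.integrable_norm_pow two_ne_zero),
    integral_add hsq hinner, integral_const_mul]

lemma integral_sq_norm_sum_of_orthogonal {D : ℕ → Ω → H} (hD : ∀ t, MemLp (D t) 2 μ)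
    (horth : ∀ t, ∫ ω, inner ℝ (D t ω) (∑ i ∈ Finset.range t, D i ω) ∂μ = 0) (T : ℕ) :
    ∫ ω, ‖∑ t ∈ Finset.range T, D t ω‖ ^ 2 ∂μ =
      ∑ t ∈ Finset.range T, ∫ ω, ‖D t ω‖ ^ 2 ∂μ := by
  induction T with
  | zero => simp
  | succ T ih =>
    simp only [Finset.sum_range_succ, add_comm _ (D T _)]
    rw [integral_sq_norm_add (hD T) (memLp_finsetSum _ fun t _ => hD t), horth, ih]
    ring

end SecondMoments

section Independence

variable {Ω A S : Type*} {mΩ : MeasurableSpace Ω} [MeasurableSpace A] [MeasurableSpace S]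
  {μ : Measure Ω} [IsProbabilityMeasure μ] {ν : Measure S} {U : Ω → A} {V : Ω → S}

lemma lintegral_comp_prodMk_of_indepFun (h : IndepFun U V μ) (hU : Measurable U)
    (hV : Measurable V) (hlaw : μ.map V = ν) {φ : A × S → ENNReal} (hφ : Measurable φ) :
    ∫⁻ ω, φ (U ω, V ω) ∂μ = ∫⁻ ω, ∫⁻ s, φ (U ω, s) ∂ν ∂μ := by
  have hprod := (indepFun_iff_map_prod_eq_prod_map_map hU.aemeasurable hV.aemeasurable).1 h
  have : IsProbabilityMeasure (μ.map V) := Measure.isProbabilityMeasure_map hV.aemeasurable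
  rw [← lintegral_map hφ (hU.prodMk hV), hprod, lintegral_prod _ hφ.aemeasurable,
    lintegral_map hφ.lintegral_prod_right' hU, hlaw]

lemma integral_comp_prodMk_of_indepFun (h : IndepFun U V μ) (hU : Measurable U)
    (hV : Measurable V) (hlaw : μ.map V = ν) {φ : A × S → ℝ} (hφ : Measurable φ)
    (h_int : Integrable (fun ω => φ (U ω, V ω)) μ) :
    ∫ ω, φ (U ω, V ω) ∂μ = ∫ ω, ∫ s, φ (U ω, s) ∂ν ∂μ := by
  have hprod := (indepFun_iff_map_prod_eq_prod_map_map hU.aemeasurable hV.aemeasurable).1 h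
  have : IsProbabilityMeasure (μ.map V) := Measure.isProbabilityMeasure_map hV.aemeasurable
  have : IsProbabilityMeasure (μ.map U) := Measure.isProbabilityMeasure_map hU.aemeasurable
  have hi : Integrable φ (μ.map fun ω => (U ω, V ω)) :=
    (integrable_map_measure hφ.aestronglyMeasurable (hU.prodMk hV).aemeasurable).2 h_int
  rw [← integral_map (hU.prodMk hV).aemeasurable hφ.aestronglyMeasurable, hprod,
    integral_prod _ (hprod ▸ hi), integral_map hU.aemeasurable, hlaw]
  exact hφ.stronglyMeasurable.integral_prod_right'.aestronglyMeasurable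

end Independence

section Oracle

variable {A H S : Type*} [MeasurableSpace A] [MeasurableSpace S]
  [NormedAddCommGroup H] [MeasurableSpace H]

/-- A stochastic oracle `G`, answering the query `a` with `G a s` for a random sample `s` of
law `ν`, whose second moment is at most `M ^ 2` at every query in `D`. -/
structure BoundedOracle (D : Set A) (ν : Measure S) (G : A → S → H) (M : ℝ) : Prop where
  measurable : Measurable (Function.uncurry G)
  moment_le : ∀ a ∈ D, ∫⁻ s, ‖G a s‖ₑ ^ 2 ∂ν ≤ ENNReal.ofReal (M ^ 2)

/-- Queries `U t` in `D` adapted to the filtration `ℱ`, each answered with a sample `V t` of law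
`ν` that is independent of the past `ℱ t` and known at time `t + 1`. -/
structure SequentialQueries {Ω : Type*} {mΩ : MeasurableSpace Ω} (D : Set A) (ν : Measure S)
    (μ : Measure Ω) (ℱ : Filtration ℕ mΩ) (U : ℕ → Ω → A) (V : ℕ → Ω → S) : Prop where
  measurable_query : ∀ t, Measurable[ℱ t] (U t)
  query_mem : ∀ t ω, U t ω ∈ D
  measurable_sample : ∀ t, Measurable[ℱ (t + 1)] (V t)
  map_sample : ∀ t, μ.map (V t) = ν
  indep_sample : ∀ t, Indep (ℱ t) (MeasurableSpace.comap (V t) inferInstance) μ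

namespace BoundedOracle

variable {D : Set A} {ν : Measure S} {G : A → S → H} {M : ℝ}

lemma neg [BorelSpace H] (hG : BoundedOracle D ν G M) :
    BoundedOracle D ν (fun a s => -G a s) M :=
  ⟨hG.measurable.neg, by simpa only [enorm_neg] using hG.moment_le⟩

variable [BorelSpace H] [SecondCountableTopology H]

lemma memLp_two (hG : BoundedOracle D ν G M) {a : A} (ha : a ∈ D) :
    MemLp (G a) 2 ν ∧ ∫ s, ‖G a s‖ ^ 2 ∂ν ≤ M ^ 2 :=
  memLp_two_of_lintegral_sq_le hG.measurable.of_uncurry_left.aestronglyMeasurable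
    (hG.moment_le a ha)

lemma measurable_mean [NormedSpace ℝ H] [SFinite ν] (hG : BoundedOracle D ν G M) :
    Measurable fun a => ∫ s, G a s ∂ν :=
  hG.measurable.stronglyMeasurable.integral_prod_right'.measurable

variable {Ω : Type*} {mΩ : MeasurableSpace Ω} {μ : Measure Ω} [IsProbabilityMeasure μ]
  {ℱ : Filtration ℕ mΩ} {U : ℕ → Ω → A} {V : ℕ → Ω → S}

lemma memLp_answer (hG : BoundedOracle D ν G M) (hQ : SequentialQueries D ν μ ℱ U V) (t : ℕ) :
    MemLp (fun ω => G (U t ω) (V t ω)) 2 μ ∧ ∫ ω, ‖G (U t ω) (V t ω)‖ ^ 2 ∂μ ≤ M ^ 2 := by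
  have hU : Measurable (U t) := (hQ.measurable_query t).mono (ℱ.le t) le_rfl
  have hV : Measurable (V t) := (hQ.measurable_sample t).mono (ℱ.le _) le_rfl
  have hUV : IndepFun (U t) (V t) μ := (IndepFun_iff_Indep _ _ _).2
    (indep_of_indep_of_le_left (hQ.indep_sample t) (hQ.measurable_query t).comap_le)
  refine memLp_two_of_lintegral_sq_le
    (hG.measurable.comp (hU.prodMk hV)).aestronglyMeasurable ?_
  calc ∫⁻ ω, ‖G (U t ω) (V t ω)‖ₑ ^ 2 ∂μ
      = ∫⁻ ω, ∫⁻ s, ‖G (U t ω) s‖ₑ ^ 2 ∂ν ∂μ :=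
        lintegral_comp_prodMk_of_indepFun hUV hU hV (hQ.map_sample t)
          (φ := fun q => ‖G q.1 q.2‖ₑ ^ 2) (hG.measurable.enorm.pow_const 2)
    _ ≤ ∫⁻ _, ENNReal.ofReal (M ^ 2) ∂μ :=
        lintegral_mono fun ω => hG.moment_le _ (hQ.query_mem t ω)
    _ = ENNReal.ofReal (M ^ 2) := by simp

variable {η : ℝ} {x : ℕ → Ω → H}

lemma memLp_sub_initial (hG : BoundedOracle D ν G M) (hQ : SequentialQueries D ν μ ℱ U V)
    (hx : ∀ t, Measurable[ℱ t] (x t))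
    (hxstep : ∀ t ω, ‖x (t + 1) ω - x 0 ω‖ ≤ ‖x t ω - x 0 ω‖ + η * ‖G (U t ω) (V t ω)‖)
    (t : ℕ) : MemLp (fun ω => x t ω - x 0 ω) 2 μ := by
  have hxm : ∀ t, Measurable (x t) := fun t => (hx t).mono (ℱ.le t) le_rfl
  induction t with
  | zero => simp
  | succ t ih =>
    exact MemLp.of_le (ih.norm.add ((hG.memLp_answer hQ t).1.norm.const_mul η))
      ((hxm (t + 1)).sub (hxm 0)).aestronglyMeasurable
      (.of_forall fun ω => (hxstep t ω).trans (Real.le_norm_self _))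

variable [InnerProductSpace ℝ H] [IsProbabilityMeasure ν]

lemma memLp_mean (hG : BoundedOracle D ν G M) (hQ : SequentialQueries D ν μ ℱ U V) (t : ℕ) :
    MemLp (fun ω => ∫ s, G (U t ω) s ∂ν) 2 μ := by
  refine MemLp.of_bound (hG.measurable_mean.comp
    ((hQ.measurable_query t).mono (ℱ.le t) le_rfl)).aestronglyMeasurable |M|
    (.of_forall fun ω => ?_)
  obtain ⟨hLp, hM⟩ := hG.memLp_two (hQ.query_mem t ω)
  exact abs_norm (∫ s, G (U t ω) s ∂ν) ▸ sq_le_sq.1 ((sq_norm_integral_le hLp).trans hM)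

lemma memLp_mean_sub (hG : BoundedOracle D ν G M) (hQ : SequentialQueries D ν μ ℱ U V) (t : ℕ) :
    MemLp (fun ω => ∫ s, G (U t ω) s ∂ν - G (U t ω) (V t ω)) 2 μ :=
  (hG.memLp_mean hQ t).sub (hG.memLp_answer hQ t).1

variable [CompleteSpace H]

lemma integral_inner_mean_sub_eq_zero (hG : BoundedOracle D ν G M)
    (hQ : SequentialQueries D ν μ ℱ U V) (t : ℕ) {W : Ω → H} (hW : Measurable[ℱ t] W)
    (hW2 : MemLp W 2 μ) :
    ∫ ω, inner ℝ (∫ s, G (U t ω) s ∂ν - G (U t ω) (V t ω)) (W ω) ∂μ = 0 := by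
  have hUW : Measurable[ℱ t] fun ω => (U t ω, W ω) := (hQ.measurable_query t).prodMk hW
  have hUWV : IndepFun (fun ω => (U t ω, W ω)) (V t) μ := (IndepFun_iff_Indep _ _ _).2
    (indep_of_indep_of_le_left (hQ.indep_sample t) hUW.comap_le)
  have hφ : Measurable fun q : (A × H) × S =>
      inner ℝ (∫ s, G q.1.1 s ∂ν - G q.1.1 q.2) q.1.2 :=
    ((hG.measurable_mean.comp measurable_fst.fst).sub
      (hG.measurable.comp (measurable_fst.fst.prodMk measurable_snd))).inner measurable_fst.snd
  rw [integral_comp_prodMk_of_indepFun hUWV (hUW.mono (ℱ.le t) le_rfl)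
    ((hQ.measurable_sample t).mono (ℱ.le _) le_rfl) (hQ.map_sample t) hφ
    (integrable_inner_of_memLp_two (hG.memLp_mean_sub hQ t) hW2)]
  refine integral_eq_zero_of_ae (.of_forall fun ω => ?_)
  have h_int : Integrable (G (U t ω)) ν :=
    (hG.memLp_two (hQ.query_mem t ω)).1.integrable one_le_two
  have hcentred : ∫ s, (∫ s, G (U t ω) s ∂ν - G (U t ω) s) ∂ν = 0 := by
    rw [integral_sub (integrable_const _) h_int, integral_const, probReal_univ, one_smul, sub_self]
  simp only [real_inner_comm (W ω), Pi.zero_apply]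
  rw [integral_inner (by exact (integrable_const _).sub h_int), hcentred, inner_zero_right]

lemma integral_sq_norm_mean_sub_le (hG : BoundedOracle D ν G M)
    (hQ : SequentialQueries D ν μ ℱ U V) (t : ℕ) :
    ∫ ω, ‖∫ s, G (U t ω) s ∂ν - G (U t ω) (V t ω)‖ ^ 2 ∂μ ≤ M ^ 2 := by
  have hmean := hG.memLp_mean hQ t
  have hpyth := integral_sq_norm_add (hG.memLp_mean_sub hQ t).neg hmean
  simp only [Pi.neg_apply, neg_sub, sub_add_cancel] at hpyth
  have horth := hG.integral_inner_mean_sub_eq_zero hQ t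
    (hG.measurable_mean.comp (hQ.measurable_query t)) hmean
  have horth' : ∫ ω, inner ℝ (G (U t ω) (V t ω) - ∫ s, G (U t ω) s ∂ν)
      (∫ s, G (U t ω) s ∂ν) ∂μ = 0 := by
    rw [← neg_eq_zero, ← integral_neg, ← horth]
    simp only [← inner_neg_left, neg_sub, Function.comp_apply]
  have hnonneg : 0 ≤ ∫ ω, ‖∫ s, G (U t ω) s ∂ν‖ ^ 2 ∂μ := integral_nonneg fun ω => sq_nonneg _
  simp only [norm_sub_rev (∫ s, G (U t _) s ∂ν)]
  linarith [(hG.memLp_answer hQ t).2]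

lemma integral_sq_norm_sum_mean_sub_le (hG : BoundedOracle D ν G M)
    (hQ : SequentialQueries D ν μ ℱ U V) (T : ℕ) :
    ∫ ω, ‖∑ t ∈ Finset.range T, (∫ s, G (U t ω) s ∂ν - G (U t ω) (V t ω))‖ ^ 2 ∂μ ≤
      T * M ^ 2 := by
  have hmeas : ∀ i t, i < t →
      Measurable[ℱ t] fun ω => ∫ s, G (U i ω) s ∂ν - G (U i ω) (V i ω) := fun i t hit =>
    have hUi : Measurable[ℱ t] (U i) := (hQ.measurable_query i).mono (ℱ.mono hit.le) le_rfl
    have hVi : Measurable[ℱ t] (V i) := (hQ.measurable_sample i).mono (ℱ.mono hit) le_rfl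
    (hG.measurable_mean.comp hUi).sub (hG.measurable.comp (hUi.prodMk hVi))
  rw [integral_sq_norm_sum_of_orthogonal (hG.memLp_mean_sub hQ) fun t =>
    hG.integral_inner_mean_sub_eq_zero hQ t
      (Finset.measurable_fun_sum _ fun i hi => hmeas i t (Finset.mem_range.1 hi))
      (memLp_finsetSum _ fun i _ => hG.memLp_mean_sub hQ i)]
  exact (Finset.sum_le_sum fun t _ => hG.integral_sq_norm_mean_sub_le hQ t).trans_eq (by simp)

lemma integral_proxNoise_le (hG : BoundedOracle D ν G M) (hQ : SequentialQueries D ν μ ℱ U V)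
    (hη : 0 ≤ η) (hx : ∀ t, Measurable[ℱ t] (x t))
    (hxstep : ∀ t ω, ‖x (t + 1) ω - x 0 ω‖ ≤ ‖x t ω - x 0 ω‖ + η * ‖G (U t ω) (V t ω)‖)
    (T : ℕ) :
    Integrable (fun ω => proxNoise η (fun t => G (U t ω) (V t ω))
        (fun t => ∫ s, G (U t ω) s ∂ν) (fun t => x t ω) T) μ ∧
      ∫ ω, proxNoise η (fun t => G (U t ω) (V t ω))
        (fun t => ∫ s, G (U t ω) s ∂ν) (fun t => x t ω) T ∂μ ≤ T * (η * M ^ 2) := by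
  have hx0 : ∀ t, Measurable[ℱ t] fun ω => x t ω - x 0 ω := fun t =>
    (hx t).sub ((hx 0).mono (ℱ.mono (Nat.zero_le t)) le_rfl)
  have hxLp := hG.memLp_sub_initial hQ hx hxstep
  have hsqInt : ∀ t ∈ Finset.range T, Integrable (fun ω => ‖G (U t ω) (V t ω)‖ ^ 2) μ :=
    fun t _ => (hG.memLp_answer hQ t).1.integrable_norm_pow two_ne_zero
  have hcrossInt : ∀ t ∈ Finset.range T, Integrable (fun ω => inner ℝ
      (∫ s, G (U t ω) s ∂ν - G (U t ω) (V t ω)) (x t ω - x 0 ω)) μ :=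
    fun t _ => integrable_inner_of_memLp_two (hG.memLp_mean_sub hQ t) (hxLp t)
  have hsumInt : Integrable (fun ω => ‖∑ t ∈ Finset.range T,
      (∫ s, G (U t ω) s ∂ν - G (U t ω) (V t ω))‖ ^ 2) μ :=
    (memLp_finsetSum _ fun t _ => hG.memLp_mean_sub hQ t).integrable_norm_pow two_ne_zero
  have hquad := (integrable_finsetSum _ hsqInt).const_mul (η / 2)
  have hcross := integrable_finsetSum _ hcrossInt
  refine ⟨(hquad.add hcross).add (hsumInt.const_mul _), ?_⟩
  simp only [proxNoise]
  rw [integral_add (by exact hquad.add hcross) (hsumInt.const_mul _), integral_add hquad hcross,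
    integral_const_mul, integral_const_mul, integral_finsetSum _ hsqInt,
    integral_finsetSum _ hcrossInt,
    Finset.sum_eq_zero fun t _ => hG.integral_inner_mean_sub_eq_zero hQ t (hx0 t) (hxLp t)]
  have hsq : ∑ t ∈ Finset.range T, ∫ ω, ‖G (U t ω) (V t ω)‖ ^ 2 ∂μ ≤ T * M ^ 2 :=
    (Finset.sum_le_sum fun t _ => (hG.memLp_answer hQ t).2).trans_eq (by simp)
  have hsum := hG.integral_sq_norm_sum_mean_sub_le hQ T
  linarith [mul_le_mul_of_nonneg_left (add_le_add hsq hsum) (by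
    positivity : 0 ≤ η / 2)]

end BoundedOracle

end Oracle

section Samples

/-- Independent samples `ξ k t` of common law `ν`, used in step `t` of epoch `k`. -/
structure IIDSamples {Ω S : Type*} [MeasurableSpace S] {mΩ : MeasurableSpace Ω} (ν : Measure S)
    (μ : Measure Ω) (ξ : ℕ → ℕ → Ω → S) : Prop where
  measurable : ∀ k t, Measurable (ξ k t)
  map_eq : ∀ k t, μ.map (ξ k t) = ν
  iIndepFun : iIndepFun (fun p : ℕ × ℕ => ξ p.1 p.2) μ

namespace IIDSamples

variable {Ω S : Type*} [MeasurableSpace S] {mΩ : MeasurableSpace Ω} {ν : Measure S}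
  {μ : Measure Ω} {ξ : ℕ → ℕ → Ω → S}

/-- The filtration of epoch `k`: at time `t` it is generated by all samples drawn before step `t`
of epoch `k`, including those of the earlier epochs. -/
def history (hξ : IIDSamples ν μ ξ) (k : ℕ) : Filtration ℕ mΩ where
  seq t := ⨆ p ∈ {p : ℕ × ℕ | p.1 < k ∨ (p.1 = k ∧ p.2 < t)},
    MeasurableSpace.comap (ξ p.1 p.2) inferInstance
  mono' _ _ h := biSup_mono fun _ hp => hp.imp_right fun hp => ⟨hp.1, hp.2.trans_le h⟩
  le' _ := iSup₂_le fun _ _ => (hξ.measurable _ _).comap_le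

lemma measurable_history (hξ : IIDSamples ν μ ξ) {j i k t : ℕ} (h : j < k ∨ (j = k ∧ i < t)) :
    Measurable[hξ.history k t] (ξ j i) :=
  (comap_measurable (ξ j i)).mono
    (le_biSup (fun p : ℕ × ℕ => MeasurableSpace.comap (ξ p.1 p.2) inferInstance)
      (i := (j, i)) h) le_rfl

lemma indep_history (hξ : IIDSamples ν μ ξ) (k t : ℕ) :
    Indep (hξ.history k t) (MeasurableSpace.comap (ξ k t) inferInstance) μ := by
  have h := indep_iSup_of_disjoint
    (m := fun p : ℕ × ℕ => MeasurableSpace.comap (ξ p.1 p.2) inferInstance)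
    (fun p => (hξ.measurable p.1 p.2).comap_le) hξ.iIndepFun.iIndep
    (S := {p : ℕ × ℕ | p.1 < k ∨ (p.1 = k ∧ p.2 < t)}) (T := {(k, t)}) (by simp)
  rwa [iSup_singleton] at h

end IIDSamples

end Samples

section Algorithm

variable {E F S : Type*} [NormedAddCommGroup E] [InnerProductSpace ℝ E]
  [NormedAddCommGroup F] [InnerProductSpace ℝ F]

/-- The iterates `(x_t, y_t)`, `t = 0, 1, …`, of epoch `k` of the whole algorithm. -/
def epochRun (X : Set E) (Y : Set F) (Gx : E → F → S → E) (Gy : E → F → S → F)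
    (γ ρ lam : ℝ) (p₀ : E × F) (s : ℕ → ℕ → S) (k : ℕ) : ℕ → E × F :=
  epochIter X Y Gx Gy γ ρ lam k (epochStart X Y Gx Gy γ ρ lam p₀ s k) (s k)

/-- The error per step of epoch `k` when it is run along `z` with the samples `s`. The `y`-update
is a proximal step along `-Gy`, an estimate of a subgradient of the convex function `-f(x, ·)`. -/
def epochNoise [MeasurableSpace S] (ν : Measure S) (Gx : E → F → S → E) (Gy : E → F → S → F)
    (ρ lam : ℝ) (k : ℕ) (z : ℕ → E × F) (s : ℕ → S) : ℝ :=
  (proxNoise (4 / (ρ * ((k : ℝ) + 1))) (fun t => Gx (z t).1 (z t).2 (s t))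
      (fun t => ∫ s, Gx (z t).1 (z t).2 s ∂ν) (fun t => (z t).1) (epochLen k)
    + proxNoise (2 / (lam * ((k : ℝ) + 1))) (fun t => -Gy (z t).1 (z t).2 (s t))
      (fun t => ∫ s, -Gy (z t).1 (z t).2 s ∂ν) (fun t => (z t).2) (epochLen k)) / epochLen k

variable {X : Set E} {Y : Set F} {Gx : E → F → S → E} {Gy : E → F → S → F} {γ ρ lam : ℝ}

lemma gdaStep_eq_proxStep (ηx ηy : ℝ) (c : E) (c' : F) (p : E × F) (s : S) :
    gdaStep X Y Gx Gy γ ηx ηy c p s =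
      (proxStep X γ ηx c p.1 (Gx p.1 p.2 s), proxStep Y 0 ηy c' p.2 (-Gy p.1 p.2 s)) := by
  have hy : proxObj 0 ηy c' p.2 (-Gy p.1 p.2 s) = fun y =>
      -inner ℝ y (Gy p.1 p.2 s) + 1 / (2 * ηy) * ‖y - p.2‖ ^ 2 := by
    ext y
    simp [proxObj, inner_neg_right]
  rw [proxStep, proxStep, hy]
  rfl

lemma epochIter_succ (k t : ℕ) (p : E × F) (c' : F) (s : ℕ → S) :
    epochIter X Y Gx Gy γ ρ lam k p s (t + 1) =
      (proxStep X γ (4 / (ρ * ((k : ℝ) + 1))) p.1 (epochIter X Y Gx Gy γ ρ lam k p s t).1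
          (Gx (epochIter X Y Gx Gy γ ρ lam k p s t).1
            (epochIter X Y Gx Gy γ ρ lam k p s t).2 (s t)),
        proxStep Y 0 (2 / (lam * ((k : ℝ) + 1))) c' (epochIter X Y Gx Gy γ ρ lam k p s t).2
          (-Gy (epochIter X Y Gx Gy γ ρ lam k p s t).1
            (epochIter X Y Gx Gy γ ρ lam k p s t).2 (s t))) :=
  gdaStep_eq_proxStep _ _ _ _ _ _

lemma epochStart_succ (p : E × F) (s : ℕ → ℕ → S) {k : ℕ} (hk : 1 ≤ k) :
    epochStart X Y Gx Gy γ ρ lam p s (k + 1) = (epochLen k : ℝ)⁻¹ •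
      ∑ t ∈ Finset.range (epochLen k), epochRun X Y Gx Gy γ ρ lam p s k t := by
  obtain ⟨j, rfl⟩ := Nat.exists_eq_add_of_le' hk
  rw [epochStart]
  rfl

lemma epochLen_pos (k : ℕ) : 0 < epochLen k := Nat.ceil_pos.2 (by positivity)

section Feasibility

variable [CompleteSpace E] [CompleteSpace F] (hX : Convex ℝ X) (hXc : IsClosed X)
  (hY : Convex ℝ Y) (hYc : IsClosed Y) (hγ : 0 ≤ γ) (hρ : 0 < ρ) (hlam : 0 < lam)
include hX hXc hY hYc hγ hρ hlam

lemma epochIter_mem (k : ℕ) {p : E × F} (hp : p ∈ X ×ˢ Y) (s : ℕ → S) (t : ℕ) :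
    epochIter X Y Gx Gy γ ρ lam k p s t ∈ X ×ˢ Y := by
  cases t with
  | zero => exact hp
  | succ t =>
    rw [epochIter_succ (c' := p.2)]
    exact ⟨(proxStep_spec hX hXc (by positivity) hγ ⟨_, hp.1⟩ _ _ _).1,
      (proxStep_spec hY hYc (by positivity) le_rfl ⟨_, hp.2⟩ _ _ _).1⟩

lemma epochStart_mem {p : E × F} (hp : p ∈ X ×ˢ Y) (s : ℕ → ℕ → S) :
    ∀ k, epochStart X Y Gx Gy γ ρ lam p s k ∈ X ×ˢ Y
  | 0 => by rwa [epochStart]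
  | 1 => by rwa [epochStart]
  | k + 2 => by
    rw [epochStart_succ p s k.succ_pos]
    exact inv_smul_sum_range_mem (hX.prod hY)
      (epochIter_mem hX hXc hY hYc hγ hρ hlam _ (epochStart_mem hp s (k + 1)) _) (epochLen_pos _)

lemma epochRun_mem {p : E × F} (hp : p ∈ X ×ˢ Y) (s : ℕ → ℕ → S) (k t : ℕ) :
    epochRun X Y Gx Gy γ ρ lam p s k t ∈ X ×ˢ Y :=
  epochIter_mem hX hXc hY hYc hγ hρ hlam k
    (epochStart_mem hX hXc hY hYc hγ hρ hlam hp s k) (s k) t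

variable [MeasurableSpace E] [BorelSpace E] [SecondCountableTopology E]
  [MeasurableSpace F] [BorelSpace F] [SecondCountableTopology F] [MeasurableSpace S]
  (hGx : Measurable (Function.uncurry fun (p : E × F) s => Gx p.1 p.2 s))
  (hGy : Measurable (Function.uncurry fun (p : E × F) s => Gy p.1 p.2 s))
  {Ω : Type*} {m : MeasurableSpace Ω}
include hGx hGy

lemma measurable_epochIter (hXne : X.Nonempty) (hYne : Y.Nonempty) (k : ℕ) {p : Ω → E × F}
    (hp : Measurable p) {s : ℕ → Ω → S} {t : ℕ} (hs : ∀ i < t, Measurable (s i)) :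
    Measurable fun ω => epochIter X Y Gx Gy γ ρ lam k (p ω) (fun i => s i ω) t := by
  induction t with
  | zero => exact hp
  | succ t ih =>
    simp only [epochIter_succ (Y := Y) (c' := (0 : F))]
    have hz := ih fun i hi => hs i (hi.trans t.lt_succ_self)
    have hzs := hz.prodMk (hs t t.lt_succ_self)
    have hx := (continuous_proxStep (η := 4 / (ρ * ((k : ℝ) + 1))) hX hXc (by positivity) hγ
      hXne).measurable.comp (hp.fst.prodMk (hz.fst.prodMk (hGx.comp hzs)))
    have hy := (continuous_proxStep (η := 2 / (lam * ((k : ℝ) + 1))) hY hYc (by positivity)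
      le_rfl hYne).measurable.comp
        ((measurable_const (a := (0 : F))).prodMk (hz.snd.prodMk (hGy.comp hzs).neg))
    exact hx.prodMk hy

lemma measurable_epochStart {p : E × F} (hp : p ∈ X ×ˢ Y) {s : ℕ → ℕ → Ω → S} :
    ∀ k, (∀ j < k, ∀ t, Measurable (s j t)) →
      Measurable fun ω => epochStart X Y Gx Gy γ ρ lam p (fun j t => s j t ω) k
  | 0, _ => by simp only [epochStart, measurable_const]
  | 1, _ => by simp only [epochStart, measurable_const]
  | k + 2, hs => by
    have ih := measurable_epochStart hp (s := s) (k + 1) fun j hj => hs j (hj.trans (by simp))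
    simp only [epochStart_succ p _ k.succ_pos]
    exact (Finset.measurable_fun_sum _ fun t _ =>
      measurable_epochIter hX hXc hY hYc hγ hρ hlam hGx hGy ⟨_, hp.1⟩ ⟨_, hp.2⟩ _ ih
        fun i _ => hs _ (by simp) i).const_smul ((epochLen (k + 1) : ℝ)⁻¹)

end Feasibility

end Algorithm

section StochasticOracle

variable {E F S Ω : Type*} [NormedAddCommGroup E] [InnerProductSpace ℝ E] [CompleteSpace E]
  [NormedAddCommGroup F] [InnerProductSpace ℝ F] [CompleteSpace F]
  [MeasurableSpace E] [MeasurableSpace F] [MeasurableSpace S]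

/-- An oracle for the saddle problem of `f` on `X × Y`: `Gx` is an unbiased estimate of a
subgradient of `f(·, y)` and `-Gy` one of a subgradient of `-f(x, ·)`, with second moments at most
`M₁ ^ 2` and `M₂ ^ 2`. -/
structure StochasticSubgradientOracle (X : Set E) (Y : Set F) (f : E → F → ℝ) (ν : Measure S)
    (Gx : E → F → S → E) (Gy : E → F → S → F) (M₁ M₂ : ℝ) : Prop where
  left : BoundedOracle (X ×ˢ Y) ν (fun p : E × F => Gx p.1 p.2) M₁
  right : BoundedOracle (X ×ˢ Y) ν (fun p : E × F => Gy p.1 p.2) M₂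
  mean_mem_left : ∀ x ∈ X, ∀ y ∈ Y, ∫ s, Gx x y s ∂ν ∈ limitingSubdiff X (fun z => f z y) x
  mean_mem_right : ∀ x ∈ X, ∀ y ∈ Y, -∫ s, Gy x y s ∂ν ∈ limitingSubdiff Y (fun z => -f x z) y

variable {X : Set E} {Y : Set F} {f : E → F → ℝ} {ν : Measure S}
  {Gx : E → F → S → E} {Gy : E → F → S → F} {γ ρ lam M₁ M₂ : ℝ}

namespace WeaklyConvexStronglyConcave

lemma proxTrajectory_epochRun (W : WeaklyConvexStronglyConcave X Y ρ lam f)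
    (O : StochasticSubgradientOracle X Y f ν Gx Gy M₁ M₂) (hγ : 0 ≤ γ) {p : E × F}
    (hp : p ∈ X ×ˢ Y) (s : ℕ → ℕ → S) (k : ℕ) {z : ℕ → E × F}
    (hz : epochRun X Y Gx Gy γ ρ lam p s k = z) :
    ProxTrajectory X Y f γ (4 / (ρ * ((k : ℝ) + 1))) (2 / (lam * ((k : ℝ) + 1)))
      (fun t => (z t).1) (fun t => Gx (z t).1 (z t).2 (s k t))
      (fun t => ∫ s, Gx (z t).1 (z t).2 s ∂ν)
      (fun t => (z t).2) (fun t => -Gy (z t).1 (z t).2 (s k t))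
      (fun t => ∫ s, -Gy (z t).1 (z t).2 s ∂ν) := by
  subst hz
  have hmem := epochRun_mem (Gx := Gx) (Gy := Gy) W.convex_left W.closed_left W.convex_right
    W.closed_right hγ W.pos_left W.pos_right hp s k
  have hstep := fun t => epochIter_succ (X := X) (Y := Y) (Gx := Gx) (Gy := Gy) (γ := γ) (ρ := ρ)
    (lam := lam) k t (epochStart X Y Gx Gy γ ρ lam p s k)
    (epochStart X Y Gx Gy γ ρ lam p s k).2 (s k)
  exact
    { step_left := fun t => congrArg Prod.fst (hstep t)
      step_right := fun t => congrArg Prod.snd (hstep t)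
      mean_mem_left := fun t => O.mean_mem_left _ (hmem t).1 _ (hmem t).2
      mean_mem_right := fun t => by
        rw [integral_neg]
        exact O.mean_mem_right _ (hmem t).1 _ (hmem t).2 }

lemma saddleGap_epochStart_succ_le (W : WeaklyConvexStronglyConcave X Y ρ lam f)
    (O : StochasticSubgradientOracle X Y f ν Gx Gy M₁ M₂) {p : E × F} (hp : p ∈ X ×ˢ Y)
    (s : ℕ → ℕ → S) {q : ℕ → E × F} (hq : q = epochStart X Y Gx Gy (2 * ρ) ρ lam p s) {k : ℕ}
    (hk : 1 ≤ k) :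
    saddleGap X Y (regObj (2 * ρ) (q k).1 f) (q (k + 1)).1 (q (k + 1)).2 ≤
      1 / 10 * saddleGap X Y (regObj (2 * ρ) (q k).1 f) (q k).1 (q k).2
        + 11 / 10 * epochNoise ν Gx Gy ρ lam k (epochRun X Y Gx Gy (2 * ρ) ρ lam p s k) (s k) := by
  have hρ := W.pos_left
  have hlam := W.pos_right
  have hlen : 106 * ((k : ℝ) + 1) / 3 ≤ epochLen k := Nat.le_ceil _
  have hk' : (1 : ℝ) ≤ k := by exact_mod_cast hk
  have hTx : 1 / (4 / (ρ * ((k : ℝ) + 1))) + 2 * ρ / 2 ≤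
      epochLen k * (1 / 44 * (2 * ρ - ρ)) := by
    rw [one_div_div]
    nlinarith
  have hTy : 1 / (2 / (lam * ((k : ℝ) + 1))) ≤ epochLen k * (1 / 44 * lam) := by
    rw [one_div_div]
    nlinarith
  -- `θ = 1 / 44` is chosen so that `4 θ / (1 - 4 θ) = 1 / 10`.
  have h : (1 - 4 * (1 / 44)) *
        saddleGap X Y (regObj (2 * ρ) (q k).1 f) (q (k + 1)).1 (q (k + 1)).2 ≤
      4 * (1 / 44) * saddleGap X Y (regObj (2 * ρ) (q k).1 f) (q k).1 (q k).2
        + epochNoise ν Gx Gy ρ lam k (epochRun X Y Gx Gy (2 * ρ) ρ lam p s k) (s k) := by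
    rw [hq, epochStart_succ p s hk]
    simp only [Prod.smul_fst, Prod.smul_snd, Prod.fst_sum, Prod.snd_sum]
    exact W.saddleGap_average_le (by linarith) (by positivity) (by positivity)
      (W.proxTrajectory_epochRun O (by positivity) hp s k rfl) (epochLen_pos k) hTx hTy
  linarith

variable [BorelSpace E] [SecondCountableTopology E] [BorelSpace F] [SecondCountableTopology F]
  {mΩ : MeasurableSpace Ω} {μ : Measure Ω} {ξ : ℕ → ℕ → Ω → S}

lemma sequentialQueries_epochRun (W : WeaklyConvexStronglyConcave X Y ρ lam f)
    (O : StochasticSubgradientOracle X Y f ν Gx Gy M₁ M₂) (hξ : IIDSamples ν μ ξ) (hγ : 0 ≤ γ)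
    {p : E × F} (hp : p ∈ X ×ˢ Y) (k : ℕ) :
    SequentialQueries (X ×ˢ Y) ν μ (hξ.history k)
      (fun t ω => epochRun X Y Gx Gy γ ρ lam p (fun j t => ξ j t ω) k t) (ξ k) where
  measurable_query _ :=
    measurable_epochIter W.convex_left W.closed_left W.convex_right W.closed_right hγ W.pos_left
      W.pos_right O.left.measurable O.right.measurable W.nonempty_left W.nonempty_right k
      (measurable_epochStart W.convex_left W.closed_left W.convex_right W.closed_right hγ
        W.pos_left W.pos_right O.left.measurable O.right.measurable hp k
        fun _ hj _ => hξ.measurable_history (.inl hj))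
      fun _ hi => hξ.measurable_history (.inr ⟨rfl, hi⟩)
  query_mem t _ := epochRun_mem W.convex_left W.closed_left W.convex_right W.closed_right hγ
    W.pos_left W.pos_right hp _ k t
  measurable_sample t := hξ.measurable_history (.inr ⟨rfl, t.lt_succ_self⟩)
  map_sample := hξ.map_eq k
  indep_sample := hξ.indep_history k

variable [IsProbabilityMeasure μ] [IsProbabilityMeasure ν]

lemma integral_epochNoise_le (W : WeaklyConvexStronglyConcave X Y ρ lam f)
    (O : StochasticSubgradientOracle X Y f ν Gx Gy M₁ M₂) (hξ : IIDSamples ν μ ξ) (hγ : 0 ≤ γ)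
    {p : E × F} (hp : p ∈ X ×ˢ Y) (k : ℕ) :
    Integrable (fun ω => epochNoise ν Gx Gy ρ lam k
        (epochRun X Y Gx Gy γ ρ lam p (fun j t => ξ j t ω) k) fun t => ξ k t ω) μ ∧
      ∫ ω, epochNoise ν Gx Gy ρ lam k
        (epochRun X Y Gx Gy γ ρ lam p (fun j t => ξ j t ω) k) (fun t => ξ k t ω) ∂μ ≤
        2 * (2 * M₁ ^ 2 / ρ + M₂ ^ 2 / lam) * (1 / ((k : ℝ) + 1)) := by
  have hρ := W.pos_left
  have hlam := W.pos_right
  have hQ := W.sequentialQueries_epochRun O hξ hγ hp k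
  obtain ⟨hxint, hx⟩ := O.left.integral_proxNoise_le hQ (η := 4 / (ρ * ((k : ℝ) + 1)))
    (by positivity) (fun t => (hQ.measurable_query t).fst)
    (fun t ω => by
      have R := W.proxTrajectory_epochRun O hγ hp (fun j t => ξ j t ω) k rfl
      rw [R.step_left]
      exact norm_proxStep_sub_center_le W.convex_left W.closed_left (by positivity) hγ
        (hQ.query_mem 0 ω).1 _ _) (epochLen k)
  obtain ⟨hyint, hy⟩ := O.right.neg.integral_proxNoise_le hQ (η := 2 / (lam * ((k : ℝ) + 1)))
    (by positivity) (fun t => (hQ.measurable_query t).snd)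
    (fun t ω => by
      have R := W.proxTrajectory_epochRun O hγ hp (fun j t => ξ j t ω) k rfl
      rw [R.step_right]
      exact norm_proxStep_sub_center_le W.convex_right W.closed_right (by positivity) le_rfl
        (hQ.query_mem 0 ω).2 _ _) (epochLen k)
  have hT : (0 : ℝ) < epochLen k := Nat.cast_pos.2 (epochLen_pos k)
  refine ⟨(hxint.add hyint).div_const _, ?_⟩
  simp only [epochNoise]
  rw [integral_div, integral_add hxint hyint, div_le_iff₀ hT]
  refine (add_le_add hx hy).trans_eq ?_
  field_simp
  ring

end WeaklyConvexStronglyConcave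

end StochasticOracle

section EpochCount

lemma sum_one_div_succ_le_log (K : ℕ) :
    ∑ k ∈ Finset.Icc 1 K, 1 / ((k : ℝ) + 1) ≤ Real.log ((K : ℝ) + 1) := by
  induction K with
  | zero => simp
  | succ K ih =>
    have hK : (0 : ℝ) < (K : ℝ) + 1 := by positivity
    have hK' : (0 : ℝ) < (K : ℝ) + 1 + 1 := by positivity
    have hlog := Real.log_le_sub_one_of_pos (div_pos hK hK')
    have hratio : ((K : ℝ) + 1) / ((K : ℝ) + 1 + 1) - 1 = -(1 / ((K : ℝ) + 1 + 1)) := by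
      field_simp; ring
    rw [Real.log_div hK.ne' hK'.ne', hratio] at hlog
    rw [Finset.sum_Icc_succ_top (by omega)]
    push_cast
    linarith

lemma log_le_two_mul_log_add_div_sq {a x : ℝ} (ha : 0 < a) (hx : 0 < x) :
    Real.log x ≤ 2 * Real.log a + x / a ^ 2 := by
  have h := Real.log_le_sub_one_of_pos (show 0 < x / a ^ 2 by positivity)
  rw [Real.log_div hx.ne' (by positivity), Real.log_pow] at h
  push_cast at h
  linarith

lemma mul_sum_one_div_succ_le {a : ℝ} {K : ℕ} (hK : 1 ≤ K)
    (haK : a * Real.log a ≤ K) : a * ∑ k ∈ Finset.Icc 1 K, 1 / ((k : ℝ) + 1) ≤ 4 * K := by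
  have hK1 : (1 : ℝ) ≤ K := by exact_mod_cast hK
  have hlog := sum_one_div_succ_le_log K
  rcases le_total a 1 with ha1 | ha1
  · calc a * ∑ k ∈ Finset.Icc 1 K, 1 / ((k : ℝ) + 1) ≤ 1 * Real.log ((K : ℝ) + 1) :=
          mul_le_mul ha1 hlog (Finset.sum_nonneg fun k _ => by positivity) zero_le_one
      _ ≤ 4 * K := by
          linarith [Real.log_le_sub_one_of_pos (show (0 : ℝ) < K + 1 by positivity)]
  · have ha0 : 0 < a := by linarith
    have hrest : ((K : ℝ) + 1) / a ≤ 2 * K := by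
      rw [div_le_iff₀ ha0]
      nlinarith
    calc a * ∑ k ∈ Finset.Icc 1 K, 1 / ((k : ℝ) + 1)
        ≤ a * (2 * Real.log a + ((K : ℝ) + 1) / a ^ 2) := by
          gcongr
          exact hlog.trans (log_le_two_mul_log_add_div_sq ha0 (by positivity))
      _ = 2 * (a * Real.log a) + ((K : ℝ) + 1) / a := by field_simp
      _ ≤ 4 * K := by linarith

lemma one_le_numEpochs (γ ρ lam M₁ M₂ ε₀ ε : ℝ) : 1 ≤ numEpochs γ ρ lam M₁ M₂ ε₀ ε :=
  le_max_left _ _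

lemma epochBound_le_of_numEpochs_le {γ ρ lam M₁ M₂ ε₀ ε : ℝ} {K : ℕ}
    (hK : numEpochs γ ρ lam M₁ M₂ ε₀ ε ≤ K) : epochBound γ ρ lam M₁ M₂ ε₀ ε ≤ K :=
  Nat.ceil_le.1 ((le_max_right _ _).trans hK)

lemma average_gap_add_noise_le_sq {ρ lam M₁ M₂ ε₀ ε : ℝ} (hρ : 0 < ρ) (hε : 0 < ε)
    {K : ℕ} (hK : numEpochs (2 * ρ) ρ lam M₁ M₂ ε₀ ε ≤ K) :
    (2 * ρ) ^ 2 * ((K : ℝ)⁻¹ * (5 / (2 * ρ) * (9 / 10 * ε₀ + 11 / 10 *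
      ∑ k ∈ Finset.Icc 1 K, 2 * (2 * M₁ ^ 2 / ρ + M₂ ^ 2 / lam) * (1 / ((k : ℝ) + 1))))) ≤
      ε ^ 2 := by
  have hK1 : 1 ≤ K := (one_le_numEpochs ..).trans hK
  have hK0 : (0 : ℝ) < K := by exact_mod_cast hK1
  have hbound := epochBound_le_of_numEpochs_le hK
  rw [epochBound, max_le_iff] at hbound
  rw [← Finset.mul_sum]
  set C := 2 * M₁ ^ 2 / ρ + M₂ ^ 2 / lam
  set H := ∑ k ∈ Finset.Icc 1 K, 1 / ((k : ℝ) + 1)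
  have hgap : 1376 * (2 * ρ) * ε₀ ≤ K * (5 * ε ^ 2) :=
    (div_le_iff₀ (by positivity)).1 hbound.2
  have hnoise : 1696 * (2 * ρ) * C * H ≤ 4 * K * ε ^ 2 := by
    rw [← div_le_iff₀ (by positivity), ← div_mul_eq_mul_div]
    exact mul_sum_one_div_succ_le hK1 hbound.1
  calc (2 * ρ) ^ 2 * ((K : ℝ)⁻¹ * (5 / (2 * ρ) * (9 / 10 * ε₀ + 11 / 10 * (2 * C * H))))
      = (9 * (ρ * ε₀) + 22 * (ρ * C * H)) / K := by field_simp; ring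
    _ ≤ ε ^ 2 := by
        rw [div_le_iff₀ hK0]
        have : 0 ≤ K * ε ^ 2 := by positivity
        linarith

lemma epochLen_le {k : ℕ} (hk : 1 ≤ k) : (epochLen k : ℝ) ≤ 74 * k := by
  have hceil := (Nat.ceil_lt_add_one (by positivity : 0 ≤ 106 * ((k : ℝ) + 1) / 3)).le
  have hk' : (1 : ℝ) ≤ k := by exact_mod_cast hk
  unfold epochLen
  linarith

lemma sum_epochLen_le (K : ℕ) :
    ((∑ k ∈ Finset.Icc 1 K, epochLen k : ℕ) : ℝ) ≤ 74 * (K : ℝ) ^ 2 := by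
  push_cast
  calc ∑ k ∈ Finset.Icc 1 K, (epochLen k : ℝ) ≤ ∑ _k ∈ Finset.Icc 1 K, 74 * (K : ℝ) := by
        refine Finset.sum_le_sum fun k hk => (epochLen_le (Finset.mem_Icc.1 hk).1).trans ?_
        gcongr
        exact (Finset.mem_Icc.1 hk).2
    _ = 74 * (K : ℝ) ^ 2 := by
        rw [Finset.sum_const, Nat.card_Icc, Nat.add_sub_cancel, nsmul_eq_mul]
        ring

lemma tendsto_log_one_div_nhdsGT_zero :
    Tendsto (fun ε : ℝ => Real.log (1 / ε)) (𝓝[>] 0) atTop := by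
  simp only [one_div]
  exact Real.tendsto_log_atTop.comp tendsto_inv_nhdsGT_zero

lemma const_isBigO_log_one_div (C : ℝ) :
    (fun _ : ℝ => C) =O[𝓝[>] 0] fun ε : ℝ => Real.log (1 / ε) :=
  (Asymptotics.isLittleO_const_left.2
    (.inr (tendsto_norm_atTop_atTop.comp tendsto_log_one_div_nhdsGT_zero))).isBigO

lemma const_isBigO_one_div_sq_mul_log (C : ℝ) :
    (fun _ : ℝ => C) =O[𝓝[>] 0] fun ε : ℝ => 1 / ε ^ 2 * Real.log (1 / ε) := by
  have hsq : Tendsto (fun ε : ℝ => 1 / ε ^ 2) (𝓝[>] 0) atTop := by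
    simp only [one_div, ← inv_pow]
    exact (tendsto_pow_atTop two_ne_zero).comp tendsto_inv_nhdsGT_zero
  have hone : (fun _ : ℝ => (1 : ℝ)) =O[𝓝[>] 0] fun ε : ℝ => 1 / ε ^ 2 :=
    (Asymptotics.isLittleO_const_left.2 (.inr (tendsto_norm_atTop_atTop.comp hsq))).isBigO
  simpa only [one_mul] using hone.mul (const_isBigO_log_one_div C)

lemma div_sq_isBigO_one_div_sq_mul_log (A : ℝ) :
    (fun ε : ℝ => A / ε ^ 2) =O[𝓝[>] 0] fun ε : ℝ => 1 / ε ^ 2 * Real.log (1 / ε) :=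
  ((Asymptotics.isBigO_refl (fun ε : ℝ => 1 / ε ^ 2) _).mul
    (const_isBigO_log_one_div A)).congr_left fun _ => one_div_mul_eq_div _ _

lemma div_sq_mul_log_isBigO (A : ℝ) :
    (fun ε : ℝ => A / ε ^ 2 * Real.log (A / ε ^ 2)) =O[𝓝[>] 0]
      fun ε : ℝ => 1 / ε ^ 2 * Real.log (1 / ε) := by
  rcases eq_or_ne A 0 with rfl | hA
  · simpa using const_isBigO_one_div_sq_mul_log 0
  have hlog : (fun ε : ℝ => Real.log A + 2 * Real.log (1 / ε)) =ᶠ[𝓝[>] 0]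
      fun ε : ℝ => Real.log (A / ε ^ 2) := by
    filter_upwards [self_mem_nhdsWithin] with ε hε
    have hε : ε ≠ 0 := (Set.mem_Ioi.1 hε).ne'
    rw [Real.log_div hA (pow_ne_zero 2 hε), Real.log_pow, one_div, Real.log_inv]
    push_cast
    ring
  have hsq : (fun ε : ℝ => A / ε ^ 2) =O[𝓝[>] 0] fun ε : ℝ => 1 / ε ^ 2 :=
    ((Asymptotics.isBigO_refl (fun ε : ℝ => 1 / ε ^ 2) (𝓝[>] 0)).const_mul_left A).congr_left
      fun _ => mul_one_div _ _
  exact hsq.mul (((const_isBigO_log_one_div (Real.log A)).add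
    ((Asymptotics.isBigO_refl _ _).const_mul_left 2)).congr' hlog .rfl)

lemma numEpochs_le (γ ρ lam M₁ M₂ ε₀ ε : ℝ) :
    (numEpochs γ ρ lam M₁ M₂ ε₀ ε : ℝ) ≤ |epochBound γ ρ lam M₁ M₂ ε₀ ε| + 1 := by
  rw [numEpochs, Nat.cast_max, Nat.cast_one]
  refine max_le (by linarith [abs_nonneg (epochBound γ ρ lam M₁ M₂ ε₀ ε)]) ?_
  calc ((⌈epochBound γ ρ lam M₁ M₂ ε₀ ε⌉₊ : ℕ) : ℝ)
      ≤ (⌈|epochBound γ ρ lam M₁ M₂ ε₀ ε|⌉₊ : ℕ) := by gcongr; exact le_abs_self _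
    _ ≤ |epochBound γ ρ lam M₁ M₂ ε₀ ε| + 1 := (Nat.ceil_lt_add_one (abs_nonneg _)).le

lemma numEpochs_isBigO (γ ρ lam M₁ M₂ ε₀ : ℝ) :
    (fun ε : ℝ => (numEpochs γ ρ lam M₁ M₂ ε₀ ε : ℝ)) =O[𝓝[>] 0]
      fun ε : ℝ => 1 / ε ^ 2 * Real.log (1 / ε) := by
  set A := 1696 * γ * (2 * M₁ ^ 2 / ρ + M₂ ^ 2 / lam)
  have hbound (ε : ℝ) : (numEpochs γ ρ lam M₁ M₂ ε₀ ε : ℝ) ≤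
      |A / ε ^ 2 * Real.log (A / ε ^ 2)| + |1376 * γ * ε₀ / 5 / ε ^ 2| + 1 := by
    have hmax := abs_max_le_max_abs_abs (a := A / ε ^ 2 * Real.log (A / ε ^ 2))
      (b := 1376 * γ * ε₀ / (5 * ε ^ 2))
    rw [div_div]
    exact (numEpochs_le ..).trans (add_le_add_left (hmax.trans
      (max_le_add_of_nonneg (abs_nonneg _) (abs_nonneg _))) 1)
  refine (Asymptotics.IsBigO.of_bound 1 (.of_forall fun ε => ?_)).trans
    (((div_sq_mul_log_isBigO A).abs_left.add
      (div_sq_isBigO_one_div_sq_mul_log (1376 * γ * ε₀ / 5)).abs_left).add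
      (const_isBigO_one_div_sq_mul_log 1))
  rw [Real.norm_of_nonneg (Nat.cast_nonneg _), one_mul]
  exact (hbound ε).trans (le_abs_self _)

lemma sum_epochLen_numEpochs_isBigO (γ ρ lam M₁ M₂ ε₀ : ℝ) :
    (fun ε : ℝ => ((∑ k ∈ Finset.Icc 1 (numEpochs γ ρ lam M₁ M₂ ε₀ ε), epochLen k : ℕ) : ℝ))
      =O[𝓝[>] 0] fun ε : ℝ => 1 / ε ^ 4 * Real.log (1 / ε) ^ 2 := by
  have hsq (ε : ℝ) : (1 / ε ^ 2 * Real.log (1 / ε)) ^ 2 = 1 / ε ^ 4 * Real.log (1 / ε) ^ 2 := by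
    ring
  simp only [← hsq]
  refine (Asymptotics.IsBigO.of_bound 74 (.of_forall fun ε => ?_)).trans
    ((numEpochs_isBigO γ ρ lam M₁ M₂ ε₀).pow 2)
  rw [Real.norm_of_nonneg (Nat.cast_nonneg _), Real.norm_of_nonneg (sq_nonneg _)]
  exact sum_epochLen_le _

end EpochCount

section RandomEpoch

lemma lintegral_uniformOn_Icc (K : ℕ) (g : ℕ → ENNReal) :
    ∫⁻ k, g k ∂(uniformOn (Set.Icc 1 K)) = (K : ENNReal)⁻¹ * ∑ k ∈ Finset.Icc 1 K, g k := by
  rw [uniformOn, ProbabilityTheory.cond, lintegral_smul_measure, ← Finset.coe_Icc, lintegral_finset,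
    Measure.count_apply_finset]
  simp

variable {Ω A : Type*} {mΩ : MeasurableSpace Ω} [MeasurableSpace A] {μ : Measure Ω}

lemma lintegral_comp_of_map_eq_uniformOn [IsProbabilityMeasure μ] {τ : Ω → ℕ} {U : Ω → A} {K : ℕ}
    (hτ : Measurable τ) (hlaw : μ.map τ = uniformOn (Set.Icc 1 K)) (hU : Measurable U)
    (hind : IndepFun τ U μ) {h : ℕ → A → ENNReal} (hh : ∀ k, Measurable (h k)) :
    ∫⁻ ω, h (τ ω) (U ω) ∂μ = (K : ENNReal)⁻¹ * ∑ k ∈ Finset.Icc 1 K, ∫⁻ ω, h k (U ω) ∂μ := by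
  rw [lintegral_comp_prodMk_of_indepFun hind.symm hU hτ hlaw (φ := fun q => h q.2 q.1)
    (measurable_from_prod_countable_left hh)]
  simp only [lintegral_uniformOn_Icc]
  have hm : ∀ k, Measurable fun ω => h k (U ω) := fun k => (hh k).comp hU
  rw [lintegral_const_mul _ (Finset.measurable_fun_sum _ fun k _ => hm k),
    lintegral_finsetSum _ fun k _ => hm k]

lemma sum_lintegral_enorm_sq_le {ι E : Type*} [NormedAddCommGroup E] [MeasurableSpace E]
    [OpensMeasurableSpace E] {s : Finset ι} {g : ι → Ω → E} (hg : ∀ i, Measurable (g i))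
    {φ : Ω → ℝ} (hφ : Integrable φ μ) (hle : ∀ ω, ∑ i ∈ s, ‖g i ω‖ ^ 2 ≤ φ ω) :
    ∑ i ∈ s, ∫⁻ ω, ‖g i ω‖ₑ ^ 2 ∂μ ≤ ENNReal.ofReal (∫ ω, φ ω ∂μ) := by
  rw [← lintegral_finsetSum _ fun i _ => (hg i).enorm.pow_const 2,
    ofReal_integral_eq_lintegral_ofReal hφ (.of_forall fun ω =>
      (Finset.sum_nonneg fun i _ => by positivity).trans (hle ω))]
  refine lintegral_mono fun ω => le_of_eq_of_le ?_ (ENNReal.ofReal_le_ofReal (hle ω))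
  rw [ENNReal.ofReal_sum_of_nonneg fun i _ => by positivity]
  refine Finset.sum_congr rfl fun i _ => ?_
  rw [ENNReal.ofReal_pow (norm_nonneg _), ofReal_norm]

end RandomEpoch

section Convergence

lemma sub_le_of_dualityGap_le {E F : Type*} {X : Set E} {Y : Set F} {f : E → F → ℝ} {x₀ : E}
    {y₀ : F} {ε₀ : ℝ} (h : dualityGap X Y f x₀ y₀ ≤ (ε₀ : EReal)) {x : E} (hx : x ∈ X) {y : F}
    (hy : y ∈ Y) : f x₀ y - f x y₀ ≤ ε₀ := by
  have hgap : ((f x₀ y - f x y₀ : ℝ) : EReal) ≤ ε₀ := by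
    rw [EReal.coe_sub]
    exact (EReal.sub_le_sub (le_iSup₂ (f := fun y' (_ : y' ∈ Y) => (f x₀ y' : EReal)) y hy)
      (iInf₂_le (f := fun x' (_ : x' ∈ X) => (f x' y₀ : EReal)) x hx)).trans h
  exact_mod_cast hgap

variable {E F S Ω : Type*} [NormedAddCommGroup E] [InnerProductSpace ℝ E] [CompleteSpace E]
  [NormedAddCommGroup F] [InnerProductSpace ℝ F] [CompleteSpace F]
  {X : Set E} {Y : Set F} {f : E → F → ℝ} {γ ρ lam M₁ M₂ ε₀ : ℝ}
  {mΩ : MeasurableSpace Ω} {μ : Measure Ω}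

namespace WeaklyConvexStronglyConcave

lemma lintegral_sq_infEDist_le (W : WeaklyConvexStronglyConcave X Y ρ lam f) (hγ : ρ < γ)
    (c : Ω → E) :
    ∫⁻ ω, Metric.infEDist 0
        (limitingSubdiff X (primalObj Y f) (saddleProx X Y γ f (c ω))) ^ 2 ∂μ ≤
      ENNReal.ofReal (γ ^ 2) * ∫⁻ ω, ‖saddleProx X Y γ f (c ω) - c ω‖ₑ ^ 2 ∂μ := by
  rw [← lintegral_const_mul' _ _ ENNReal.ofReal_ne_top]
  refine lintegral_mono fun ω => ?_
  rw [ENNReal.ofReal_pow (W.pos_left.trans hγ).le, ← mul_pow]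
  exact pow_le_pow_left' (W.infEDist_limitingSubdiff_le hγ _) 2

lemma nearlyStationaryInMean [MeasurableSpace E] [BorelSpace E]
    (W : WeaklyConvexStronglyConcave X Y ρ lam f)
    (hγ : ρ < γ) {c : Ω → E} (hc : Measurable c) {ε : ℝ}
    (h : ENNReal.ofReal (γ ^ 2) * ∫⁻ ω, ‖saddleProx X Y γ f (c ω) - c ω‖ₑ ^ 2 ∂μ ≤
      ENNReal.ofReal (ε ^ 2)) :
    NearlyStationaryInMean μ X (primalObj Y f) (1 / γ) ε c := by
  have hγ₀ : 0 < γ := W.pos_left.trans hγ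
  refine ⟨fun ω => saddleProx X Y γ f (c ω), (W.continuous_saddleProx hγ).measurable.comp hc, ?_,
    (W.lintegral_sq_infEDist_le hγ c).trans h⟩
  have hne : ENNReal.ofReal (γ ^ 2) ≠ 0 := (ENNReal.ofReal_pos.2 (by positivity)).ne'
  rw [← ENNReal.mul_le_mul_iff_right hne ENNReal.ofReal_ne_top,
    ← ENNReal.ofReal_mul (by positivity)]
  refine h.trans_eq (congrArg _ ?_)
  field_simp

variable [MeasurableSpace E] [MeasurableSpace F] [MeasurableSpace S] {ν : Measure S}
  {Gx : E → F → S → E} {Gy : E → F → S → F}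

lemma sum_sq_norm_saddleProx_epochStart_le (W : WeaklyConvexStronglyConcave X Y ρ lam f)
    (O : StochasticSubgradientOracle X Y f ν Gx Gy M₁ M₂) {p : E × F} (hp : p ∈ X ×ˢ Y)
    (hgap : dualityGap X Y f p.1 p.2 ≤ (ε₀ : EReal)) (s : ℕ → ℕ → S) {q : ℕ → E × F}
    (hq : q = epochStart X Y Gx Gy (2 * ρ) ρ lam p s) (K : ℕ) :
    ∑ k ∈ Finset.Icc 1 K, ‖saddleProx X Y (2 * ρ) f (q k).1 - (q k).1‖ ^ 2 ≤
      5 / (2 * ρ) * (9 / 10 * ε₀ + 11 / 10 * ∑ k ∈ Finset.Icc 1 K,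
        epochNoise ν Gx Gy ρ lam k (epochRun X Y Gx Gy (2 * ρ) ρ lam p s k) (s k)) := by
  have hρ := W.pos_left
  have hmem (k : ℕ) : q k ∈ X ×ˢ Y := by
    rw [hq]
    exact epochStart_mem W.convex_left W.closed_left W.convex_right W.closed_right
      (by positivity) hρ W.pos_right hp s k
  have hq1 : q 1 = p := by rw [hq, epochStart]
  have h := W.sum_sq_dist_saddleProx_le (c := fun k => (q k).1) (y := fun k => (q k).2)
    (fun k => (hmem k).1) (fun k => (hmem k).2)
    (fun u hu v hv => by
      rw [hq1]
      exact sub_le_of_dualityGap_le hgap hu hv)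
    (fun k hk => W.saddleGap_epochStart_succ_le O hp s hq hk) K
  rw [← Finset.mul_sum] at h
  rw [div_mul_eq_mul_div, le_div_iff₀ (by positivity)]
  linarith

variable [BorelSpace E] [SecondCountableTopology E] [BorelSpace F] [SecondCountableTopology F]
  {ξ : ℕ → ℕ → Ω → S}

lemma measurable_epochStart_fst (W : WeaklyConvexStronglyConcave X Y ρ lam f)
    (O : StochasticSubgradientOracle X Y f ν Gx Gy M₁ M₂) (hγ : 0 ≤ γ) {p : E × F}
    (hp : p ∈ X ×ˢ Y) {s : ℕ → ℕ → Ω → S} (hs : ∀ j t, Measurable (s j t)) (k : ℕ) :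
    Measurable fun ω => (epochStart X Y Gx Gy γ ρ lam p (fun j t => s j t ω) k).1 :=
  (measurable_epochStart W.convex_left W.closed_left W.convex_right W.closed_right hγ
    W.pos_left W.pos_right O.left.measurable O.right.measurable hp k fun j _ t => hs j t).fst

variable [IsProbabilityMeasure μ] [IsProbabilityMeasure ν]

lemma sum_lintegral_saddleProx_epochStart_le (W : WeaklyConvexStronglyConcave X Y ρ lam f)
    (O : StochasticSubgradientOracle X Y f ν Gx Gy M₁ M₂) (hξ : IIDSamples ν μ ξ) {p : E × F}
    (hp : p ∈ X ×ˢ Y) (hgap : dualityGap X Y f p.1 p.2 ≤ (ε₀ : EReal)) {c : ℕ → Ω → E}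
    (hc : ∀ k ω, c k ω = (epochStart X Y Gx Gy (2 * ρ) ρ lam p (fun j t => ξ j t ω) k).1)
    (K : ℕ) :
    ∑ k ∈ Finset.Icc 1 K, ∫⁻ ω, ‖saddleProx X Y (2 * ρ) f (c k ω) - c k ω‖ₑ ^ 2 ∂μ ≤
      ENNReal.ofReal (5 / (2 * ρ) * (9 / 10 * ε₀ + 11 / 10 * ∑ k ∈ Finset.Icc 1 K,
        2 * (2 * M₁ ^ 2 / ρ + M₂ ^ 2 / lam) * (1 / ((k : ℝ) + 1)))) := by
  have hρ := W.pos_left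
  have hγ : (0 : ℝ) ≤ 2 * ρ := by positivity
  set r : ℕ → Ω → ℝ := fun k ω => epochNoise ν Gx Gy ρ lam k
    (epochRun X Y Gx Gy (2 * ρ) ρ lam p (fun j t => ξ j t ω) k) fun t => ξ k t ω
  have hr (k : ℕ) : Integrable (r k) μ ∧
      ∫ ω, r k ω ∂μ ≤ 2 * (2 * M₁ ^ 2 / ρ + M₂ ^ 2 / lam) * (1 / ((k : ℝ) + 1)) :=
    W.integral_epochNoise_le O hξ hγ hp k
  have h_int : Integrable (fun ω => 11 / 10 * ∑ k ∈ Finset.Icc 1 K, r k ω) μ :=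
    (integrable_finsetSum _ fun k _ => (hr k).1).const_mul _
  have hc_meas (k : ℕ) : Measurable (c k) := by
    rw [funext (hc k)]
    exact W.measurable_epochStart_fst O hγ hp hξ.measurable k
  have hg (k : ℕ) : Measurable fun ω => saddleProx X Y (2 * ρ) f (c k ω) - c k ω :=
    ((W.continuous_saddleProx (by linarith)).measurable.comp (hc_meas k)).sub (hc_meas k)
  have hle (ω : Ω) : ∑ k ∈ Finset.Icc 1 K, ‖saddleProx X Y (2 * ρ) f (c k ω) - c k ω‖ ^ 2 ≤
      5 / (2 * ρ) * (9 / 10 * ε₀ + 11 / 10 * ∑ k ∈ Finset.Icc 1 K, r k ω) := by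
    simp only [hc]
    exact W.sum_sq_norm_saddleProx_epochStart_le O hp hgap (fun j t => ξ j t ω) rfl K
  refine (sum_lintegral_enorm_sq_le hg
    (((integrable_const _).add h_int).const_mul _) hle).trans (ENNReal.ofReal_le_ofReal ?_)
  rw [integral_const_mul, integral_add' (integrable_const _) h_int, integral_const, probReal_univ,
    one_smul, integral_const_mul, integral_finsetSum _ fun k _ => (hr k).1]
  gcongr with k
  exact (hr k).2

lemma lintegral_saddleProx_epochStart_le (W : WeaklyConvexStronglyConcave X Y ρ lam f)
    (O : StochasticSubgradientOracle X Y f ν Gx Gy M₁ M₂) (hξ : IIDSamples ν μ ξ) {p : E × F}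
    (hp : p ∈ X ×ˢ Y) (hgap : dualityGap X Y f p.1 p.2 ≤ (ε₀ : EReal)) {c : ℕ → Ω → E}
    (hc : ∀ k ω, c k ω = (epochStart X Y Gx Gy (2 * ρ) ρ lam p (fun j t => ξ j t ω) k).1)
    {ε : ℝ} (hε : 0 < ε) {K : ℕ} (hK : numEpochs (2 * ρ) ρ lam M₁ M₂ ε₀ ε ≤ K)
    {τ : Ω → ℕ} (hτ : Measurable τ) (hlaw : μ.map τ = uniformOn (Set.Icc 1 K))
    (hind : IndepFun τ (fun ω (i : ℕ × ℕ) => ξ i.1 i.2 ω) μ) :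
    ENNReal.ofReal ((2 * ρ) ^ 2) *
        ∫⁻ ω, ‖saddleProx X Y (2 * ρ) f (c (τ ω) ω) - c (τ ω) ω‖ₑ ^ 2 ∂μ ≤
      ENNReal.ofReal (ε ^ 2) := by
  have hρ := W.pos_left
  have hK0 : (0 : ℝ) < K := by exact_mod_cast (one_le_numEpochs ..).trans hK
  set Ψ : ℕ → (ℕ × ℕ → S) → E := fun k s =>
    (epochStart X Y Gx Gy (2 * ρ) ρ lam p (fun j t => s (j, t)) k).1
  have hΨ (k : ℕ) : Measurable (Ψ k) :=
    W.measurable_epochStart_fst O (by positivity) hp (s := fun j t (s : ℕ × ℕ → S) => s (j, t))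
      (fun j t => measurable_pi_apply (j, t)) k
  have havg : ∫⁻ ω, ‖saddleProx X Y (2 * ρ) f (c (τ ω) ω) - c (τ ω) ω‖ₑ ^ 2 ∂μ =
      (K : ENNReal)⁻¹ * ∑ k ∈ Finset.Icc 1 K,
        ∫⁻ ω, ‖saddleProx X Y (2 * ρ) f (c k ω) - c k ω‖ₑ ^ 2 ∂μ := by
    simp only [hc]
    exact lintegral_comp_of_map_eq_uniformOn hτ hlaw
      (measurable_pi_lambda _ fun i => hξ.measurable i.1 i.2) hind
      (h := fun k s => ‖saddleProx X Y (2 * ρ) f (Ψ k s) - Ψ k s‖ₑ ^ 2) fun k =>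
      (((W.continuous_saddleProx (by linarith)).measurable.comp (hΨ k)).sub
        (hΨ k)).enorm.pow_const 2
  have hsum := W.sum_lintegral_saddleProx_epochStart_le O hξ hp hgap hc K
  rw [havg]
  refine (mul_le_mul_right (mul_le_mul_right hsum _) _).trans ?_
  rw [← ENNReal.ofReal_natCast, ← ENNReal.ofReal_inv_of_pos hK0,
    ← ENNReal.ofReal_mul (by positivity), ← ENNReal.ofReal_mul (by positivity)]
  exact ENNReal.ofReal_le_ofReal (average_gap_add_noise_le_sq hρ hε hK)

end WeaklyConvexStronglyConcave

end Convergence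

end

lemma WeaklyConvexStronglyConcave.of_continuousOn {E F : Type*} [NormedAddCommGroup E]
    [InnerProductSpace ℝ E] [NormedAddCommGroup F] [InnerProductSpace ℝ F] {X : Set E} {Y : Set F}
    {f : E → F → ℝ} {ρ lam : ℝ} (hf : ContinuousOn (fun p : E × F => f p.1 p.2) (X ×ˢ Y))
    (hX : IsClosed X) (hY : IsClosed Y) (hX₀ : X.Nonempty) (hY₀ : Y.Nonempty) (hρ : 0 < ρ)
    (hlam : 0 < lam) (hwc : ∀ y ∈ Y, WeaklyConvexOn X ρ fun x => f x y)
    (hsc : ∀ x ∈ X, StrongConcaveOn Y lam (f x)) : WeaklyConvexStronglyConcave X Y ρ lam f where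
  closed_left := hX
  closed_right := hY
  nonempty_left := hX₀
  nonempty_right := hY₀
  pos_left := hρ
  pos_right := hlam
  weaklyConvex := hwc
  concave := hsc
  lsc_left y hy := (hf.comp (f := fun x => (x, y)) (Continuous.continuousOn (by fun_prop))
    fun _ hx => ⟨hx, hy⟩).lowerSemicontinuousOn
  usc_right x hx := (hf.comp (f := fun y => (x, y)) (Continuous.continuousOn (by fun_prop))
    fun _ hy => ⟨hx, hy⟩).upperSemicontinuousOn

lemma StochasticSubgradientOracle.of_measurable_prod {E F S : Type*} [NormedAddCommGroup E]
    [InnerProductSpace ℝ E] [MeasurableSpace E] [NormedAddCommGroup F] [InnerProductSpace ℝ F]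
    [MeasurableSpace F] [MeasurableSpace S] {X : Set E} {Y : Set F} {f : E → F → ℝ}
    {ν : Measure S} {Gx : E → F → S → E} {Gy : E → F → S → F} {M₁ M₂ : ℝ}
    (hGx : Measurable fun p : E × F × S => Gx p.1 p.2.1 p.2.2)
    (hGy : Measurable fun p : E × F × S => Gy p.1 p.2.1 p.2.2)
    (hGx_sub : ∀ x ∈ X, ∀ y ∈ Y, ∫ s, Gx x y s ∂ν ∈ limitingSubdiff X (fun z => f z y) x)
    (hGy_sub : ∀ x ∈ X, ∀ y ∈ Y, -∫ s, Gy x y s ∂ν ∈ limitingSubdiff Y (fun z => -f x z) y)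
    (hGx_mom : ∀ x ∈ X, ∀ y ∈ Y, ∫⁻ s, ‖Gx x y s‖ₑ ^ 2 ∂ν ≤ ENNReal.ofReal (M₁ ^ 2))
    (hGy_mom : ∀ x ∈ X, ∀ y ∈ Y, ∫⁻ s, ‖Gy x y s‖ₑ ^ 2 ∂ν ≤ ENNReal.ofReal (M₂ ^ 2)) :
    StochasticSubgradientOracle X Y f ν Gx Gy M₁ M₂ where
  left := ⟨hGx.comp MeasurableEquiv.prodAssoc.measurable, fun _ hp => hGx_mom _ hp.1 _ hp.2⟩
  right := ⟨hGy.comp MeasurableEquiv.prodAssoc.measurable, fun _ hp => hGy_mom _ hp.1 _ hp.2⟩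
  mean_mem_left := hGx_sub
  mean_mem_right := hGy_sub

theorem theorem2_general {E F S Ω : Type*}
    [NormedAddCommGroup E] [InnerProductSpace ℝ E] [CompleteSpace E] [SecondCountableTopology E]
    [MeasurableSpace E] [BorelSpace E]
    [NormedAddCommGroup F] [InnerProductSpace ℝ F] [CompleteSpace F] [SecondCountableTopology F]
    [MeasurableSpace F] [BorelSpace F] [MeasurableSpace S] [MeasurableSpace Ω]
    {X : Set E} {Y : Set F} {f : E → F → ℝ} {ρ lam γ M₁ M₂ ε₀ : ℝ}
    (W : WeaklyConvexStronglyConcave X Y ρ lam f) (hγ : γ = 2 * ρ)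
    {ν : Measure S} [IsProbabilityMeasure ν] {Gx : E → F → S → E} {Gy : E → F → S → F}
    (O : StochasticSubgradientOracle X Y f ν Gx Gy M₁ M₂)
    {p : E × F} (hp : p ∈ X ×ˢ Y) (hgap : dualityGap X Y f p.1 p.2 ≤ (ε₀ : EReal))
    {μ : Measure Ω} [IsProbabilityMeasure μ] {ξ : ℕ → ℕ → Ω → S} (hξ : IIDSamples ν μ ξ)
    {xs xhat : ℕ → Ω → E}
    (hxs : ∀ k ω, xs k ω = (epochStart X Y Gx Gy γ ρ lam p (fun j t => ξ j t ω) k).1)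
    (hxhat : ∀ k ω, xhat k ω = saddleProx X Y γ f (xs k ω)) :
    (∀ k ω, ∃! q, IsSaddle X Y (regObj γ (xs k ω) f) q) ∧
    (∀ ε : ℝ, 0 < ε → ∀ K : ℕ, numEpochs γ ρ lam M₁ M₂ ε₀ ε ≤ K →
      ∀ τ : Ω → ℕ, Measurable τ → μ.map τ = uniformOn (Set.Icc 1 K) →
        IndepFun τ (fun ω (i : ℕ × ℕ) => ξ i.1 i.2 ω) μ →
        (∫⁻ ω, Metric.infEDist 0
              (limitingSubdiff X (primalObj Y f) (xhat (τ ω) ω)) ^ 2 ∂μ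
            ≤ ENNReal.ofReal (γ ^ 2) * ∫⁻ ω, ‖xhat (τ ω) ω - xs (τ ω) ω‖ₑ ^ 2 ∂μ) ∧
        (ENNReal.ofReal (γ ^ 2) * ∫⁻ ω, ‖xhat (τ ω) ω - xs (τ ω) ω‖ₑ ^ 2 ∂μ
            ≤ ENNReal.ofReal (ε ^ 2)) ∧
        NearlyStationaryInMean μ X (primalObj Y f) (1 / γ) ε (fun ω => xs (τ ω) ω)) ∧
    (fun ε : ℝ => ((∑ k ∈ Finset.Icc 1 (numEpochs γ ρ lam M₁ M₂ ε₀ ε), epochLen k : ℕ) : ℝ))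
      =O[𝓝[>] 0] fun ε : ℝ => 1 / ε ^ 4 * Real.log (1 / ε) ^ 2 := by
  have hργ : ρ < γ := by linarith [W.pos_left]
  refine ⟨fun k ω => (W.strongConvexConcave_regObj hργ _).existsUnique_isSaddle, ?_,
    sum_epochLen_numEpochs_isBigO ..⟩
  intro ε hε K hK τ hτ hlaw hind
  subst hγ
  have hxs_meas : Measurable fun ω => xs (τ ω) ω := by
    refine (measurable_from_prod_countable_left (f := fun q : Ω × ℕ => xs q.2 q.1) fun k => ?_).comp
      (measurable_id.prodMk hτ)
    simp only [hxs]
    exact W.measurable_epochStart_fst O (W.pos_left.trans hργ).le hp hξ.measurable k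
  simp only [hxhat]
  have hbound := W.lintegral_saddleProx_epochStart_le O hξ hp hgap hxs hε hK hτ hlaw hind
  exact ⟨W.lintegral_sq_infEDist_le hργ _, hbound, W.nearlyStationaryInMean hργ hxs_meas hbound⟩

theorem theorem2 {d n : ℕ}
    (X : Set (EuclideanSpace ℝ (Fin d))) (Y : Set (EuclideanSpace ℝ (Fin n)))
    (hXc : IsClosed X) (hXconv : Convex ℝ X) (hYc : IsClosed Y) (hYconv : Convex ℝ Y)
    (f : EuclideanSpace ℝ (Fin d) → EuclideanSpace ℝ (Fin n) → ℝ)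
    (hf : ContinuousOn (fun p : EuclideanSpace ℝ (Fin d) × EuclideanSpace ℝ (Fin n) => f p.1 p.2)
      (X ×ˢ Y))
    (ρ lam γ : ℝ) (hρ : 0 < ρ) (hlam : 0 < lam) (hγ : γ = 2 * ρ)
    (hwc : ∀ y ∈ Y, WeaklyConvexOn X ρ fun x => f x y)
    (hsc : ∀ x ∈ X, StrongConcaveOn Y lam fun y => f x y)
    -- the stochastic subgradient oracle
    {S : Type*} [MeasurableSpace S] (ν : Measure S) [IsProbabilityMeasure ν]
    (Gx : EuclideanSpace ℝ (Fin d) → EuclideanSpace ℝ (Fin n) → S → EuclideanSpace ℝ (Fin d))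
    (Gy : EuclideanSpace ℝ (Fin d) → EuclideanSpace ℝ (Fin n) → S → EuclideanSpace ℝ (Fin n))
    (hGx_meas : Measurable
      fun p : EuclideanSpace ℝ (Fin d) × EuclideanSpace ℝ (Fin n) × S => Gx p.1 p.2.1 p.2.2)
    (hGy_meas : Measurable
      fun p : EuclideanSpace ℝ (Fin d) × EuclideanSpace ℝ (Fin n) × S => Gy p.1 p.2.1 p.2.2)
    (hGx_sub : ∀ x ∈ X, ∀ y ∈ Y, (∫ s, Gx x y s ∂ν) ∈ limitingSubdiff X (fun x' => f x' y) x)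
    (hGy_sub : ∀ x ∈ X, ∀ y ∈ Y, -(∫ s, Gy x y s ∂ν) ∈ limitingSubdiff Y (fun y' => -f x y') y)
    (M₁ M₂ : ℝ)
    (hGx_mom : ∀ x ∈ X, ∀ y ∈ Y, ∫⁻ s, ‖Gx x y s‖ₑ ^ 2 ∂ν ≤ ENNReal.ofReal (M₁ ^ 2))
    (hGy_mom : ∀ x ∈ X, ∀ y ∈ Y, ∫⁻ s, ‖Gy x y s‖ₑ ^ 2 ∂ν ≤ ENNReal.ofReal (M₂ ^ 2))
    -- the initial solution and its duality gap
    (x₀ : EuclideanSpace ℝ (Fin d)) (y₀ : EuclideanSpace ℝ (Fin n)) (hx₀ : x₀ ∈ X) (hy₀ : y₀ ∈ Y)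
    (ε₀ : ℝ) (hε₀ : 0 < ε₀) (hgap : dualityGap X Y f x₀ y₀ ≤ (ε₀ : EReal))
    -- independent samples drawn from the oracle's distribution
    {Ω : Type*} [MeasurableSpace Ω] (μ : Measure Ω) [IsProbabilityMeasure μ]
    (ξ : ℕ → ℕ → Ω → S) (hξ_meas : ∀ k t, Measurable (ξ k t))
    (hξ_law : ∀ k t, μ.map (ξ k t) = ν)
    (hξ_indep : iIndepFun (fun p : ℕ × ℕ => ξ p.1 p.2) μ)
    -- the epoch starting points and the saddle points of the regularized problems
    (xs : ℕ → Ω → EuclideanSpace ℝ (Fin d))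
    (hxs : ∀ k ω, xs k ω =
      (epochStart X Y Gx Gy γ ρ lam (x₀, y₀) (fun j t => ξ j t ω) k).1)
    (xhat : ℕ → Ω → EuclideanSpace ℝ (Fin d))
    (hxhat : ∀ k ω, xhat k ω = (saddlePoint X Y (regObj γ (xs k ω) f)).1) :
    -- the regularized problems do have unique saddle points
    (∀ k, 1 ≤ k → ∀ ω, ∃! p, IsSaddle X Y (regObj γ (xs k ω) f) p) ∧
    -- convergence for a uniformly random epoch
    (∀ ε : ℝ, 0 < ε → ∀ K : ℕ, numEpochs γ ρ lam M₁ M₂ ε₀ ε ≤ K →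
      ∀ τ : Ω → ℕ, Measurable τ → μ.map τ = uniformOn (Set.Icc 1 K) →
        IndepFun τ (fun ω (p : ℕ × ℕ) => ξ p.1 p.2 ω) μ →
        (∫⁻ ω, Metric.infEDist 0
              (limitingSubdiff X (primalObj Y f) (xhat (τ ω) ω)) ^ 2 ∂μ
            ≤ ENNReal.ofReal (γ ^ 2) * ∫⁻ ω, ‖xhat (τ ω) ω - xs (τ ω) ω‖ₑ ^ 2 ∂μ) ∧
        (ENNReal.ofReal (γ ^ 2) * ∫⁻ ω, ‖xhat (τ ω) ω - xs (τ ω) ω‖ₑ ^ 2 ∂μ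
            ≤ ENNReal.ofReal (ε ^ 2)) ∧
        NearlyStationaryInMean μ X (primalObj Y f) (1 / γ) ε (fun ω => xs (τ ω) ω)) ∧
    -- the total number of iterations is of order `ε⁻⁴` up to logarithmic factors
    (fun ε : ℝ => ((∑ k ∈ Finset.Icc 1 (numEpochs γ ρ lam M₁ M₂ ε₀ ε), epochLen k : ℕ) : ℝ))
      =O[𝓝[>] 0] fun ε : ℝ => 1 / ε ^ 4 * Real.log (1 / ε) ^ 2 := by
  have W := WeaklyConvexStronglyConcave.of_continuousOn hf hXc hYc ⟨x₀, hx₀⟩ ⟨y₀, hy₀⟩ hρ hlam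
    hwc hsc
  have O := StochasticSubgradientOracle.of_measurable_prod hGx_meas hGy_meas hGx_sub hGy_sub
    hGx_mom hGy_mom
  have h := theorem2_general W hγ O (p := (x₀, y₀)) ⟨hx₀, hy₀⟩ hgap
    ⟨hξ_meas, hξ_law, hξ_indep⟩ hxs hxhat
  exact ⟨fun k _ => h.1 k, h.2⟩
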